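/- Let $X$ be a real Banach space with dual $X^*$. Let $c(X)$ be the family of nonempty closed convex subsets of $X$, and let $cb(X)$, $cwk(X)$, $ck(X)$ be the families of bounded, weakly compact, and norm compact members of $c(X)$, respectively. For $C\in c(X)$ and $x^*\in X^*$ let $s(x^*,C)=\sup_{x\in C}\langle x^*,x\rangle\in(-\infty,+\infty]$. Let $\lambda$ be Lebesgue measure on $[0,1]$, let $\Gamma:[0,1]\to c(X)$, and for $x^*\in X^*$ write $s(x^*,\Gamma)$ for the function $t\mapsto s(x^*,\Gamma(t))$. A function $f:[0,1]\to[-\infty,+\infty]$ is Denjoy integrable (in the wide sense) if there is an ACG function $F:[0,1]\to\mathbb R$ (that is, $F$ is continuous and $[0,1]$ is a countable union of sets on each of which $F$ is absolutely continuous) whose approximate derivative exists and equals $f$ almost everywhere; then $(D)\int_{[a,b]}f=F(b)-F(a)$ for $0\le a<b\le 1$. For $\mathcal C\subset c(X)$: - $\Gamma$ is *Denjoy–Pettis integrable in $\mathcal C$* if $s(x^*,\Gamma)$ is Denjoy integrable for every $x^*\in X^*$ and for every closed interval $I\subset[0,1]$ there is $N(I)\in\mathcal C$ with $s(x^*,N(I))=(D)\int_I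 s(x^*,\Gamma)$ for all $x^*\in X^*$. - $\Gamma$ is *Pettis integrable in $\mathcal C$* if $s(x^*,\Gamma)$ is Lebesgue integrable for every $x^*\in X^*$ and for every Lebesgue measurable $A\subset[0,1]$ there is $M(A)\in\mathcal C$ with $s(x^*,M(A))=\int_A s(x^*,\Gamma)\,d\lambda$ for all $x^*\in X^*$. - $\Gamma$ is *positive* if for each $x^*\in X^*$ separately, $s(x^*,\Gamma)\ge 0$ almost everywhere. **Theorem.** Let $\Gamma:[0,1]\to c(X)$ be positive. If $\Gamma$ is Denjoy–Pettis integrable in $cb(X)$ (respectively in $cwk(X)$, in $ck(X)$), then $\Gamma$ is Pettis integrable in $cb(X)$ (respectively in $cwk(X)$, in $ck(X)$). -/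

import Mathlib

open MeasureTheory Set Filter Topology

section Multifunctions

variable (X : Type*) [NormedAddCommGroup X] [NormedSpace ℝ X]

/-- `c(X)`: the nonempty closed convex subsets of `X`. -/
def closedConvexFamily : Set (Set X) :=
  {C | C.Nonempty ∧ IsClosed C ∧ Convex ℝ C}

/-- `cb(X)`: the bounded members of `c(X)`. -/
def cbFamily : Set (Set X) :=
  {C | C ∈ closedConvexFamily X ∧ Bornology.IsBounded C}

/-- `cwk(X)`: the weakly compact members of `c(X)`. -/
def cwkFamily : Set (Set X) :=
  {C | C ∈ closedConvexFamily X ∧ IsCompact (toWeakSpace ℝ X '' C)}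

/-- `ck(X)`: the (norm) compact members of `c(X)`. -/
def ckFamily : Set (Set X) :=
  {C | C ∈ closedConvexFamily X ∧ IsCompact C}

end Multifunctions

/-- The support function `s(x*, C) = sup {⟨x*, x⟩ : x ∈ C}`. It takes the value `+∞` when `C` is
unbounded above in the direction `x*`, hence lives in the extended reals. -/
noncomputable def supportFun {X : Type*} [NormedAddCommGroup X] [NormedSpace ℝ X]
    (φ : X →L[ℝ] ℝ) (C : Set X) : EReal :=
  ⨆ x ∈ C, ((φ x : ℝ) : EReal)

/-- `F` is absolutely continuous (AC) on the set `S`: sums of increments over finite families of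
nonoverlapping intervals with endpoints in `S` are small when the total length is small. -/
def IsACOn (F : ℝ → ℝ) (S : Set ℝ) : Prop :=
  ∀ ε : ℝ, 0 < ε → ∃ δ : ℝ, 0 < δ ∧ ∀ (n : ℕ) (c d : Fin n → ℝ),
    (∀ i, c i ∈ S ∧ d i ∈ S ∧ c i ≤ d i) →
    (∀ i j, i ≠ j → Disjoint (Ioo (c i) (d i)) (Ioo (c j) (d j))) →
    ∑ i, (d i - c i) < δ → ∑ i, |F (d i) - F (c i)| < ε

/-- `F` is ACG (generalized absolutely continuous) on `S`: it is continuous on `S`, and `S` is a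
countable union of sets on each of which `F` is AC. -/
def IsACGOn (F : ℝ → ℝ) (S : Set ℝ) : Prop :=
  ContinuousOn F S ∧ ∃ T : ℕ → Set ℝ, S = ⋃ n, T n ∧ ∀ n, IsACOn F (T n)

/-- `c` is a (two-sided Lebesgue) density point of `S`. -/
def IsDensityPoint (S : Set ℝ) (c : ℝ) : Prop :=
  Tendsto (fun h : ℝ => volume (S ∩ Icc (c - h) (c + h)) / ENNReal.ofReal (2 * h))
    (𝓝[>] 0) (𝓝 1)

/-- `F` has approximate derivative `D` at `c`: the restriction of `F` to some measurable set that
has `c` as a density point (together with `c`) has derivative `D` at `c`. -/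
def HasApproxDerivAt (F : ℝ → ℝ) (D c : ℝ) : Prop :=
  ∃ S : Set ℝ, NullMeasurableSet S volume ∧ IsDensityPoint S c ∧ HasDerivWithinAt F D S c

/-- `F` is a Denjoy (wide sense, i.e. Denjoy-Khintchine) primitive on `[0,1]` of the extended real
valued function `f`: it is ACG on `[0,1]` and its approximate derivative exists and equals `f`
almost everywhere (so in particular `f` is finite almost everywhere). -/
def IsDenjoyPrimitive (f : ℝ → EReal) (F : ℝ → ℝ) : Prop :=
  IsACGOn F (Icc 0 1) ∧
    ∀ᵐ t ∂(volume.restrict (Icc (0 : ℝ) 1)), ∃ D : ℝ, HasApproxDerivAt F D t ∧ f t = (D : EReal)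

/-- `f` is Denjoy integrable (in the wide sense) on `[0,1]`. -/
def IsDenjoyIntegrable (f : ℝ → EReal) : Prop :=
  ∃ F : ℝ → ℝ, IsDenjoyPrimitive f F

/-- `v` is the Denjoy integral of `f` over `[a,b] ⊆ [0,1]`: the increment over `[a,b]` of a Denjoy
primitive of `f` (primitives are unique up to additive constants). -/
def HasDenjoyIntegral (f : ℝ → EReal) (a b v : ℝ) : Prop :=
  ∃ F : ℝ → ℝ, IsDenjoyPrimitive f F ∧ F b - F a = v

section Integrals

variable {X : Type*} [NormedAddCommGroup X] [NormedSpace ℝ X]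

/-- A multifunction `Γ : [0,1] → c(X)`; it is encoded as a function on `ℝ` whose values outside
`[0,1]` play no role. -/
def IsMultifunction (Γ : ℝ → Set X) : Prop :=
  ∀ t ∈ Icc (0 : ℝ) 1, Γ t ∈ closedConvexFamily X

/-- `Γ` is positive: for each `x*` separately, `s(x*, Γ) ≥ 0` almost everywhere on `[0,1]`. -/
def IsPositiveMultifunction (Γ : ℝ → Set X) : Prop :=
  ∀ φ : X →L[ℝ] ℝ, ∀ᵐ t ∂(volume.restrict (Icc (0 : ℝ) 1)), 0 ≤ supportFun φ (Γ t)

/-- `Γ` is Denjoy-Pettis integrable in the family `𝒞`: it is scalarly Denjoy integrable and for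
each closed interval `[a,b] ⊆ [0,1]` there is `N ∈ 𝒞` such that, for every `x*`, `s(x*, N)` is the
Denjoy integral of `s(x*, Γ)` over `[a,b]`. -/
def DenjoyPettisIntegrable (𝒞 : Set (Set X)) (Γ : ℝ → Set X) : Prop :=
  (∀ φ : X →L[ℝ] ℝ, IsDenjoyIntegrable (fun t => supportFun φ (Γ t))) ∧
    ∀ a b : ℝ, 0 ≤ a → a < b → b ≤ 1 → ∃ N ∈ 𝒞, ∀ φ : X →L[ℝ] ℝ, ∃ v : ℝ,
      HasDenjoyIntegral (fun t => supportFun φ (Γ t)) a b v ∧ supportFun φ N = (v : EReal)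

/-- `Γ` is scalarly integrable: each `s(x*, Γ)` is finite almost everywhere and Lebesgue
integrable on `[0,1]`. -/
def ScalarlyIntegrable (Γ : ℝ → Set X) : Prop :=
  ∀ φ : X →L[ℝ] ℝ,
    (∀ᵐ t ∂(volume.restrict (Icc (0 : ℝ) 1)),
      supportFun φ (Γ t) ≠ ⊤ ∧ supportFun φ (Γ t) ≠ ⊥) ∧
    IntegrableOn (fun t => (supportFun φ (Γ t)).toReal) (Icc 0 1) volume

/-- `Γ` is Pettis integrable in the family `𝒞`: it is scalarly integrable and for each Lebesgue
measurable `A ⊆ [0,1]` there is `M ∈ 𝒞` with `s(x*, M) = ∫_A s(x*, Γ) dλ` for every `x*`. -/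
def PettisIntegrable (𝒞 : Set (Set X)) (Γ : ℝ → Set X) : Prop :=
  ScalarlyIntegrable Γ ∧
    ∀ A : Set ℝ, A ⊆ Icc 0 1 → NullMeasurableSet A volume → ∃ M ∈ 𝒞, ∀ φ : X →L[ℝ] ℝ,
      supportFun φ M = ((∫ t in A, (supportFun φ (Γ t)).toReal ∂volume : ℝ) : EReal)

end Integrals

/-! Positivity makes every Denjoy primitive of s(φ, Γ) nondecreasing
(`IsDenjoyPrimitive.monotoneOn`). By Lusin's condition (N) such a primitive is the integral of its
derivative, so s(φ, Γ) is Lebesgue integrable and its Denjoy integrals over intervals are Lebesgue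
integrals.

For A ⊆ [0,1] put p(φ) = ∫_A s(φ, Γ) and M = {x | φ x ≤ p(φ) for all φ}. Positivity gives 0 ∈ M and
p ≤ ∫_[0,1] s(·, Γ), hence M ⊆ N([0,1]) by Hahn–Banach, and M inherits boundedness or compactness.
It remains to see that M is large enough, i.e. that p is the support function of M.

A weak* lower semicontinuous sublinear function is a support function
(`exists_dominated_vector_of_weakStar_lsc`). This is applied to p + ε‖·‖, whose sublevel sets are
norm bounded and so have weak* cluster points; completeness of X then removes ε
(`exists_dominated_vector_of_forall_add_norm`).

Lower semicontinuity at φ₀ reduces to sequences in two steps. The sets N(I) with rational endpoints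
yield a countable D ⊆ X such that φ = φ₀ on D forces s(φ₀, Γ) ≤ s(φ, Γ) almost everywhere. A Komlós
type selection (`exists_seq_ae_tendsto_exp_neg`) finds functionals approaching φ₀ on D whose support
functions converge almost everywhere in [0, ∞], so that Fatou's lemma bounds p at their weak*
cluster points. -/

/-! ### Absolute continuity on sets and Lusin's condition (N) -/

/-- Each order component of an open set is open and contains a rational, so the components of
rationals suffice; a rational outside `U` only contributes the empty set. -/
theorem IsOpen.exists_countable_ordConnected_partition {U : Set ℝ} (hU : IsOpen U) :
    ∃ 𝒮 : Set (Set ℝ), 𝒮.Countable ∧ 𝒮.PairwiseDisjoint id ∧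
      (∀ C ∈ 𝒮, IsOpen C ∧ OrdConnected C) ∧ ⋃₀ 𝒮 = U := by
  have hopen : ∀ x, IsOpen (ordConnectedComponent U x) := by
    intro x
    rw [isOpen_iff_mem_nhds]
    intro y hy
    rw [ordConnectedComponent_eq hy, ordConnectedComponent_mem_nhds]
    exact hU.mem_nhds (ordConnectedComponent_subset hy)
  refine ⟨range fun q : ℚ => ordConnectedComponent U q, countable_range _, ?_, ?_, ?_⟩
  · rintro _ ⟨p, rfl⟩ _ ⟨q, rfl⟩ hne
    rw [Function.onFun, Set.disjoint_left]
    intro z hp hq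
    exact hne ((ordConnectedComponent_eq hp).trans (ordConnectedComponent_eq hq).symm)
  · rintro _ ⟨q, rfl⟩
    exact ⟨hopen _, inferInstance⟩
  · apply subset_antisymm
    · rintro x ⟨_, ⟨q, rfl⟩, hx⟩
      exact ordConnectedComponent_subset hx
    · intro x hx
      obtain ⟨q, hq⟩ := (Rat.denseRange_cast (𝕜 := ℝ)).exists_mem_open (hopen x)
        ⟨x, self_mem_ordConnectedComponent.2 hx⟩
      exact ⟨_, ⟨q, rfl⟩, mem_ordConnectedComponent_comm.1 hq⟩

theorem IsACOn.exists_delta_finset {F : ℝ → ℝ} {S : Set ℝ} (hF : IsACOn F S) {ε : ℝ} (hε : 0 < ε) :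
    ∃ δ : ℝ, 0 < δ ∧ ∀ {ι : Type} (s : Finset ι) (c d : ι → ℝ),
      (∀ i ∈ s, c i ∈ S ∧ d i ∈ S ∧ c i ≤ d i) →
      (∀ i ∈ s, ∀ j ∈ s, i ≠ j → Disjoint (Ioo (c i) (d i)) (Ioo (c j) (d j))) →
      ∑ i ∈ s, (d i - c i) < δ → ∑ i ∈ s, |F (d i) - F (c i)| < ε := by
  obtain ⟨δ, hδ, h⟩ := hF ε hε
  refine ⟨δ, hδ, fun {ι} s c d hs hd hsum => ?_⟩
  have key : ∀ g : ι → ℝ, ∑ k : Fin s.card, g (s.equivFin.symm k) = ∑ i ∈ s, g i := by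
    intro g
    rw [← Finset.sum_coe_sort s g]
    exact Equiv.sum_comp s.equivFin.symm (fun i : s => g i)
  have := h s.card (fun k => c (s.equivFin.symm k)) (fun k => d (s.equivFin.symm k))
    (fun k => hs _ (s.equivFin.symm k).2)
    (fun i j hij => hd _ (s.equivFin.symm i).2 _ (s.equivFin.symm j).2 fun h' =>
      hij (s.equivFin.symm.injective (Subtype.ext h')))
    (by rwa [key (fun i => d i - c i)])
  rwa [key (fun i => |F (d i) - F (c i)|)] at this

/-- The extra slope turns a nonnegative approximate derivative into a positive one, and a
nondecreasing primitive into an injective one. -/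
theorem IsACOn.add_const_mul {F : ℝ → ℝ} {S : Set ℝ} (hF : IsACOn F S) {r : ℝ} (hr : 0 < r) :
    IsACOn (fun x => F x + r * x) S := by
  intro ε hε
  obtain ⟨δ, hδ, h⟩ := hF (ε / 2) (by positivity)
  refine ⟨min δ (ε / (2 * r)), by positivity, fun n c d hcd hdisj hsum => ?_⟩
  have h1 := h n c d hcd hdisj (hsum.trans_le (min_le_left _ _))
  have h2 : r * ∑ i, (d i - c i) < ε / 2 := by
    have := mul_lt_mul_of_pos_left (hsum.trans_le (min_le_right _ _)) hr
    rwa [show r * (ε / (2 * r)) = ε / 2 by field_simp] at this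
  calc ∑ i, |F (d i) + r * d i - (F (c i) + r * c i)|
      ≤ ∑ i, (|F (d i) - F (c i)| + r * (d i - c i)) := by
        refine Finset.sum_le_sum fun i _ => ?_
        have h3 : 0 ≤ r * (d i - c i) := mul_nonneg hr.le (sub_nonneg.2 (hcd i).2.2)
        rw [show F (d i) + r * d i - (F (c i) + r * c i) =
          (F (d i) - F (c i)) + r * (d i - c i) by ring]
        exact (abs_add_le _ _).trans (by rw [abs_of_nonneg h3])
    _ = ∑ i, |F (d i) - F (c i)| + r * ∑ i, (d i - c i) := by
        rw [Finset.sum_add_distrib, Finset.mul_sum]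
    _ < ε := by linarith

/-- Lusin's condition (N) for functions that are absolutely continuous on a set. -/
theorem IsACOn.volume_image_eq_zero {F : ℝ → ℝ} {T Z : Set ℝ} (hF : IsACOn F T)
    (hZ : volume Z = 0) : volume (F '' (T ∩ Z)) = 0 := by
  have key : ∀ ε : ℝ, 0 < ε → volume (F '' (T ∩ Z)) ≤ 2 * ENNReal.ofReal ε := by
    intro ε hε
    obtain ⟨δ, hδ, h⟩ := hF.exists_delta_finset hε
    obtain ⟨U, hZU, hUo, hUδ⟩ := Z.exists_isOpen_lt_of_lt (μ := volume) (ENNReal.ofReal δ)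
      (by rw [hZ]; simpa using hδ)
    obtain ⟨𝒮, hc, hdisj, hC, rfl⟩ := hUo.exists_countable_ordConnected_partition
    have hlen : ∀ C ∈ 𝒮, ∀ x ∈ C, ∀ y ∈ C, ENNReal.ofReal (y - x) ≤ volume C := by
      intro C hCS x hx y hy
      rw [← Real.volume_Icc]
      exact measure_mono ((hC C hCS).2.out hx hy)
    have hsumvol : ∑' C : 𝒮, volume (C : Set ℝ) < ENNReal.ofReal δ := by
      rwa [measure_sUnion hc hdisj (fun C hCS => (hC C hCS).1.measurableSet)] at hUδ
    have hfin : ∀ (s : Finset 𝒮) (c d : 𝒮 → ℝ), (∀ C ∈ s, c C ∈ T ∩ C ∧ d C ∈ T ∩ C ∧ c C ≤ d C) →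
        ∑ C ∈ s, ENNReal.ofReal |F (d C) - F (c C)| ≤ ENNReal.ofReal ε := by
      intro s c d hs
      rw [← ENNReal.ofReal_sum_of_nonneg (fun _ _ => abs_nonneg _)]
      apply ENNReal.ofReal_le_ofReal
      refine (h s c d (fun i hi => ⟨(hs i hi).1.1, (hs i hi).2.1.1, (hs i hi).2.2⟩) ?_ ?_).le
      · intro i hi j hj hij
        refine (hdisj i.2 j.2 (fun h' => hij (Subtype.ext h'))).mono ?_ ?_
        · exact Ioo_subset_Icc_self.trans ((hC i i.2).2.out (hs i hi).1.2 (hs i hi).2.1.2)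
        · exact Ioo_subset_Icc_self.trans ((hC j j.2).2.out (hs j hj).1.2 (hs j hj).2.1.2)
      · rw [← ENNReal.ofReal_lt_ofReal_iff hδ,
          ENNReal.ofReal_sum_of_nonneg (fun i hi => sub_nonneg.2 (hs i hi).2.2)]
        refine lt_of_le_of_lt (Finset.sum_le_sum fun i hi => ?_)
          ((ENNReal.sum_le_tsum s).trans_lt hsumvol)
        exact hlen i i.2 _ (hs i hi).1.2 _ (hs i hi).2.1.2
    set D : 𝒮 → ENNReal := fun C => Metric.ediam (F '' (T ∩ C)) with hD
    have hedist : ∀ x y, edist (F x) (F y) = ENNReal.ofReal |F y - F x| := by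
      intro x y
      rw [edist_dist, Real.dist_eq, abs_sub_comm]
    have hDle : ∀ C, D C ≤ ENNReal.ofReal ε := by
      intro C
      refine Metric.ediam_le ?_
      rintro _ ⟨x, hx, rfl⟩ _ ⟨y, hy, rfl⟩
      rcases le_total x y with hxy | hxy
      · rw [hedist]
        simpa using hfin {C} (fun _ => x) (fun _ => y) (by simp [hx.1, hx.2, hy.1, hy.2, hxy])
      · rw [edist_comm, hedist]
        simpa using hfin {C} (fun _ => y) (fun _ => x) (by simp [hx.1, hx.2, hy.1, hy.2, hxy])
    -- Two points of each component realise half of the oscillation `D C`, whence the factor 2; the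
    -- pair is a dummy where the oscillation vanishes.
    have hpair : ∀ C : 𝒮, ∃ p : ℝ × ℝ, D C ≠ 0 →
        (p.1 ∈ T ∩ C ∧ p.2 ∈ T ∩ C ∧ p.1 ≤ p.2) ∧
          D C / 2 ≤ ENNReal.ofReal |F p.2 - F p.1| := by
      intro C
      by_cases h0 : D C = 0
      · exact ⟨0, fun h => absurd h0 h⟩
      by_contra! hcon
      have hlt : D C / 2 < D C := ENNReal.half_lt_self h0
        ((hDle C).trans_lt ENNReal.ofReal_lt_top).ne
      refine hlt.not_ge (Metric.ediam_le ?_)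
      rintro _ ⟨x, hx, rfl⟩ _ ⟨y, hy, rfl⟩
      rcases le_total x y with hxy | hxy
      · rw [hedist]
        exact ((hcon (x, y)).2 ⟨hx, hy, hxy⟩).le
      · rw [edist_comm, hedist]
        exact ((hcon (y, x)).2 ⟨hy, hx, hxy⟩).le
    choose p hp using hpair
    have hDsum : ∑' C, D C ≤ 2 * ENNReal.ofReal ε := by
      rw [ENNReal.tsum_eq_iSup_sum]
      refine iSup_le fun s => ?_
      classical
      rw [← Finset.sum_filter_ne_zero]
      calc ∑ C ∈ s with D C ≠ 0, D C
          ≤ ∑ C ∈ s with D C ≠ 0, 2 * ENNReal.ofReal |F (p C).2 - F (p C).1| := by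
            refine Finset.sum_le_sum fun C hCs => ?_
            have := (hp C (Finset.mem_filter.1 hCs).2).2
            rw [mul_comm]
            exact (ENNReal.div_le_iff (by simp) (by simp)).1 this
        _ ≤ 2 * ENNReal.ofReal ε := by
            rw [← Finset.mul_sum]
            gcongr
            exact hfin _ (fun C => (p C).1) (fun C => (p C).2)
              fun C hCs => (hp C (Finset.mem_filter.1 hCs).2).1
    have : Countable 𝒮 := hc.to_subtype
    calc volume (F '' (T ∩ Z)) ≤ volume (⋃ C : 𝒮, F '' (T ∩ C)) := by
          apply measure_mono
          rintro _ ⟨x, hx, rfl⟩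
          obtain ⟨C, hCS, hxC⟩ := hZU hx.2
          exact mem_iUnion.2 ⟨⟨C, hCS⟩, x, ⟨hx.1, hxC⟩, rfl⟩
      _ ≤ ∑' C : 𝒮, volume (F '' (T ∩ C)) := measure_iUnion_le _
      _ ≤ ∑' C, D C := ENNReal.tsum_le_tsum fun C => Real.volume_le_diam _
      _ ≤ _ := hDsum
  have hlim : Tendsto (fun ε : ℝ => 2 * ENNReal.ofReal ε) (𝓝[>] 0) (𝓝 0) := by
    have : Tendsto (fun ε : ℝ => 2 * ENNReal.ofReal ε) (𝓝 0) (𝓝 (2 * ENNReal.ofReal 0)) :=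
      ENNReal.Tendsto.const_mul (ENNReal.continuous_ofReal.tendsto 0) (Or.inr (by simp))
    simp only [ENNReal.ofReal_zero, mul_zero] at this
    exact this.mono_left nhdsWithin_le_nhds
  exact le_antisymm (ge_of_tendsto hlim (eventually_mem_nhdsWithin.mono fun ε hε => key ε hε))
    (zero_le)

theorem IsACGOn.volume_image_eq_zero {F : ℝ → ℝ} {S Z : Set ℝ} (hF : IsACGOn F S) (hZS : Z ⊆ S)
    (hZ : volume Z = 0) : volume (F '' Z) = 0 := by
  obtain ⟨-, T, rfl, hT⟩ := hF
  refine measure_mono_null (t := ⋃ n, F '' (T n ∩ Z)) ?_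
    (measure_iUnion_null fun n => (hT n).volume_image_eq_zero hZ)
  rintro _ ⟨x, hx, rfl⟩
  obtain ⟨n, hn⟩ := mem_iUnion.1 (hZS hx)
  exact mem_iUnion.2 ⟨n, x, ⟨hn, hx⟩, rfl⟩

theorem IsACGOn.add_const_mul {F : ℝ → ℝ} {S : Set ℝ} (hF : IsACGOn F S) {r : ℝ} (hr : 0 < r) :
    IsACGOn (fun x => F x + r * x) S := by
  obtain ⟨hc, T, hT, h⟩ := hF
  exact ⟨hc.add (by fun_prop), T, hT, fun n => (h n).add_const_mul hr⟩

/-! ### Approximate derivatives and monotonicity -/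

/-- If `S` missed an interval to the right of `x`, it would fill at most half of every small
symmetric interval. -/
theorem IsDensityPoint.neBot_nhdsWithin_Ioi {S : Set ℝ} {x : ℝ} (h : IsDensityPoint S x) :
    (𝓝[S ∩ Ioi x] x).NeBot := by
  rw [← mem_closure_iff_nhdsWithin_neBot, Metric.mem_closure_iff]
  intro ε hε
  by_contra! hcon
  have hle : ∀ᶠ r : ℝ in 𝓝[>] 0,
      volume (S ∩ Icc (x - r) (x + r)) / ENNReal.ofReal (2 * r) ≤ 1 / 2 := by
    filter_upwards [Ioo_mem_nhdsGT hε] with r hr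
    have hsub : S ∩ Icc (x - r) (x + r) ⊆ Icc (x - r) x := by
      rintro y ⟨hyS, hy⟩
      refine ⟨hy.1, not_lt.1 fun hxy => ?_⟩
      have := hcon y ⟨hyS, hxy⟩
      rw [dist_comm, Real.dist_eq, abs_of_pos (sub_pos.2 hxy)] at this
      linarith [hy.2, hr.2]
    have hvol : volume (S ∩ Icc (x - r) (x + r)) ≤ ENNReal.ofReal r := by
      refine (measure_mono hsub).trans ?_
      rw [Real.volume_Icc, sub_sub_cancel]
    have hr' : ENNReal.ofReal r ≠ 0 := by simpa using hr.1
    rw [ENNReal.ofReal_mul (by norm_num), ENNReal.div_le_iff (by simp [hr.1])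
      (ENNReal.mul_ne_top (by simp) (by simp))]
    refine hvol.trans (le_of_eq ?_)
    rw [← mul_assoc, ENNReal.ofReal_ofNat, one_div, ENNReal.inv_mul_cancel (by simp) (by simp),
      one_mul]
  have := le_of_tendsto h hle
  simp at this

theorem HasApproxDerivAt.exists_tendsto_slope {F : ℝ → ℝ} {D x : ℝ} (h : HasApproxDerivAt F D x) :
    ∃ S ⊆ Ioi x, (𝓝[S] x).NeBot ∧ Tendsto (slope F x) (𝓝[S] x) (𝓝 D) := by
  obtain ⟨S, -, hS, hD⟩ := h
  exact ⟨S ∩ Ioi x, inter_subset_right, hS.neBot_nhdsWithin_Ioi,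
    (hasDerivWithinAt_iff_tendsto_slope' fun hx => lt_irrefl x hx.2).1
      (hD.mono inter_subset_left)⟩

theorem HasApproxDerivAt.add_const_mul {F : ℝ → ℝ} {D x : ℝ} (h : HasApproxDerivAt F D x) (r : ℝ) :
    HasApproxDerivAt (fun t => F t + r * t) (D + r) x := by
  obtain ⟨S, hm, hS, hD⟩ := h
  exact ⟨S, hm, hS, hD.add (by simpa using (hasDerivWithinAt_id x S).const_mul r)⟩

theorem HasApproxDerivAt.eq_deriv {F : ℝ → ℝ} {D x : ℝ} (h : HasApproxDerivAt F D x)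
    (hF : DifferentiableAt ℝ F x) : D = deriv F x := by
  obtain ⟨S, hS, hne, hD⟩ := h.exists_tendsto_slope
  refine tendsto_nhds_unique hD (hF.hasDerivAt.tendsto_slope.mono_left (nhdsWithin_mono _ ?_))
  exact fun y hy => (hS hy).ne'

/-- An ACG function with positive approximate derivative almost everywhere is nondecreasing. -/
theorem IsACGOn.le_of_ae_hasApproxDerivAt_pos {G : ℝ → ℝ} (hG : IsACGOn G (Icc 0 1))
    (hD : ∀ᵐ t ∂(volume.restrict (Icc (0 : ℝ) 1)), ∃ D : ℝ, 0 < D ∧ HasApproxDerivAt G D t)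
    {a b : ℝ} (ha : 0 ≤ a) (hab : a ≤ b) (hb : b ≤ 1) : G a ≤ G b := by
  by_contra! hlt
  have hsub : Icc a b ⊆ Icc (0 : ℝ) 1 := Icc_subset_Icc ha hb
  set Z : Set ℝ := {t | ¬ (t ∈ Icc (0 : ℝ) 1 → ∃ D : ℝ, 0 < D ∧ HasApproxDerivAt G D t)} with hZ
  have hZ0 : volume Z = 0 := by
    rw [ae_restrict_iff' measurableSet_Icc, ae_iff] at hD
    exact hD
  have hZs : Z ⊆ Icc 0 1 := fun t ht => by
    by_contra h
    exact ht fun h' => absurd h' h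
  have hGZ := hG.volume_image_eq_zero hZs hZ0
  -- The exceptional set has null image, so some intermediate level is attained only where the
  -- approximate derivative is positive.
  obtain ⟨y, hy, hyZ⟩ : ∃ y ∈ Ioo (G b) (G a), y ∉ G '' Z := by
    by_contra! hcon
    have := measure_mono_null (μ := volume) (show Ioo (G b) (G a) ⊆ G '' Z from hcon) hGZ
    rw [Real.volume_Ioo, ENNReal.ofReal_eq_zero] at this
    linarith
  have hcont : ContinuousOn G (Icc a b) := hG.1.mono hsub
  have hK : IsCompact {t ∈ Icc a b | y ≤ G t} :=
    isCompact_Icc.of_isClosed_subset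
      (hcont.preimage_isClosed_of_isClosed isClosed_Icc isClosed_Ici) (fun t ht => ht.1)
  -- At the last point `x` with `G x ≥ y` one has `G x = y`, and all slopes from the right are
  -- nonpositive.
  obtain ⟨x, ⟨hxI, hyx⟩, hmax⟩ := hK.exists_isGreatest ⟨a, ⟨le_rfl, hab⟩, hy.2.le⟩
  have hxb : x < b := lt_of_le_of_ne hxI.2 fun h => by
    rw [h] at hyx
    exact absurd hyx (not_le.2 hy.1)
  obtain ⟨t, htI, hty⟩ := intermediate_value_Icc' hxI.2
    (hcont.mono (Icc_subset_Icc hxI.1 le_rfl)) ⟨hy.1.le, hyx⟩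
  have htx : t = x :=
    le_antisymm (hmax ⟨⟨hxI.1.trans htI.1, htI.2⟩, hty.ge⟩) htI.1
  rw [htx] at hty
  have hxZ : x ∉ Z := fun h => hyZ ⟨x, h, hty⟩
  obtain ⟨D, hD0, hDx⟩ := not_not.1 hxZ (hsub hxI)
  obtain ⟨S, hS, hne, hlim⟩ := hDx.exists_tendsto_slope
  refine hD0.not_ge (le_of_tendsto hlim ?_)
  filter_upwards [self_mem_nhdsWithin, nhdsWithin_le_nhds (Iio_mem_nhds hxb)] with s hs hsb
  have hxs : x < s := hS hs
  have hGs : G s < y := by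
    by_contra! hcon
    exact absurd (hmax ⟨⟨hxI.1.trans hxs.le, le_of_lt hsb⟩, hcon⟩) (not_le.2 hxs)
  rw [slope_def_field]
  exact div_nonpos_of_nonpos_of_nonneg (by linarith) (by linarith)

/-- The strict criterion applies to F + εx for every ε > 0, and ε is arbitrary. -/
theorem IsDenjoyPrimitive.monotoneOn {f : ℝ → EReal} {F : ℝ → ℝ} (hF : IsDenjoyPrimitive f F)
    (hf : ∀ᵐ t ∂(volume.restrict (Icc (0 : ℝ) 1)), 0 ≤ f t) : MonotoneOn F (Icc 0 1) := by
  intro a ha b hb hab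
  refine le_of_forall_pos_le_add fun ε hε => ?_
  have hG := hF.1.add_const_mul hε
  have := hG.le_of_ae_hasApproxDerivAt_pos (by
    filter_upwards [hf, hF.2] with t ht ⟨D, hD, hDt⟩
    rw [hDt] at ht
    exact ⟨D + ε, add_pos_of_nonneg_of_pos (by exact_mod_cast ht) hε, hD.add_const_mul ε⟩)
    ha.1 hab hb.2
  have h1 : ε * (b - a) ≤ ε := mul_le_of_le_one_right hε.le (by linarith [ha.1, hb.2])
  linarith

/-! ### Lebesgue integrability of nonnegative Denjoy integrable functions -/

theorem MonotoneOn.ae_differentiableAt_Icc {F : ℝ → ℝ} {a b : ℝ} (hF : MonotoneOn F (Icc a b)) :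
    ∀ᵐ t ∂(volume.restrict (Icc a b)), t ∈ Ioo a b ∧ DifferentiableAt ℝ F t := by
  rw [← restrict_Ioo_eq_restrict_Icc, ae_restrict_iff' measurableSet_Ioo]
  filter_upwards [hF.ae_differentiableWithinAt_of_mem] with t ht hI
  exact ⟨hI, (ht (Ioo_subset_Icc_self hI)).differentiableAt (Icc_mem_nhds hI.1 hI.2)⟩

/-- The fundamental theorem of calculus for nondecreasing ACG functions. -/
theorem IsACGOn.integral_deriv_eq_sub {F : ℝ → ℝ} (hF : IsACGOn F (Icc 0 1))
    (hmono : MonotoneOn F (Icc 0 1)) {a b : ℝ} (ha : 0 ≤ a) (hab : a ≤ b) (hb : b ≤ 1) :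
    ∫ t in a..b, deriv F t = F b - F a := by
  have hsub : Icc a b ⊆ Icc (0 : ℝ) 1 := Icc_subset_Icc ha hb
  have hm := hmono.mono hsub
  -- `G` is injective, so the change of variables formula on the set `E` of differentiability points
  -- computes the measure of `G '' E` as the integral of F' + 1.
  set G : ℝ → ℝ := fun x => F x + 1 * x with hGdef
  have hG : IsACGOn G (Icc 0 1) := hF.add_const_mul one_pos
  have hGm : StrictMonoOn G (Icc a b) := fun x hx y hy hxy => by
    have := hm hx hy hxy.le
    simp only [hGdef]
    linarith
  set E : Set ℝ := Ioo a b ∩ {t | DifferentiableAt ℝ F t} with hE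
  have hEm : MeasurableSet E := measurableSet_Ioo.inter (measurableSet_of_differentiableAt ℝ F)
  have hEs : E ⊆ Icc a b := inter_subset_left.trans Ioo_subset_Icc_self
  have hnull : volume (Icc a b \ E) = 0 := by
    have := hm.ae_differentiableAt_Icc
    rw [ae_restrict_iff' measurableSet_Icc, ae_iff] at this
    convert this using 2
    ext t
    simp [hE, and_assoc]
  -- By condition (N), discarding the null set outside `E` costs nothing in the image.
  have himage : volume.real (G '' E) = G b - G a := by
    have h1 : G '' Icc a b = Icc (G a) (G b) := by
      apply subset_antisymm
      · rintro _ ⟨x, hx, rfl⟩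
        exact ⟨hGm.monotoneOn (left_mem_Icc.2 hab) hx hx.1,
          hGm.monotoneOn hx (right_mem_Icc.2 hab) hx.2⟩
      · exact intermediate_value_Icc hab (hG.1.mono hsub)
    have h2 : volume (G '' E) = volume (Icc (G a) (G b)) := by
      rw [← h1]
      refine le_antisymm (measure_mono (image_mono hEs)) ?_
      rw [← union_sdiff_cancel hEs, image_union]
      refine (measure_union_le _ _).trans ?_
      rw [hG.volume_image_eq_zero (sdiff_subset.trans hsub) hnull, add_zero]
    rw [measureReal_def, h2, Real.volume_Icc, ENNReal.toReal_ofReal]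
    exact sub_nonneg.2 (hGm.monotoneOn (left_mem_Icc.2 hab) (right_mem_Icc.2 hab) hab)
  have hder : ∀ t ∈ E, HasDerivWithinAt G (deriv F t + 1) E t := fun t ht =>
    (ht.2.hasDerivAt.add (hasDerivAt_const_mul (1 : ℝ))).hasDerivWithinAt
  have hnn : ∀ t ∈ E, 0 ≤ deriv F t := fun t ht => by
    rw [← derivWithin_of_mem_nhds (Icc_mem_nhds ht.1.1 ht.1.2)]
    exact hm.derivWithin_nonneg
  have hcv := integral_image_eq_integral_abs_deriv_smul hEm hder (hGm.injOn.mono hEs)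
    (fun _ => (1 : ℝ))
  have hint : IntegrableOn (deriv F) (Icc a b) := by
    have := MonotoneOn.intervalIntegrable_deriv (f := F) (a := a) (b := b) (by rwa [uIcc_of_le hab])
    rwa [intervalIntegrable_iff_integrableOn_Icc_of_le hab] at this
  have hEI : volume.restrict E = volume.restrict (Icc a b) :=
    Measure.restrict_congr_set (LE.le.eventuallyLE hEs |>.antisymm
      (ae_le_set.2 hnull))
  rw [setIntegral_const, himage, setIntegral_congr_fun (g := fun t => deriv F t + 1) hEm
    (fun t ht => by simp [abs_of_nonneg (add_nonneg (hnn t ht) zero_le_one)]), hEI,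
    integral_add hint (by simp)] at hcv
  rw [intervalIntegral.integral_of_le hab, ← integral_Icc_eq_integral_Ioc]
  simp [hab] at hcv
  simp only [hGdef] at hcv
  linarith

/-- The Denjoy integral of a nonnegative function is its Lebesgue integral. -/
theorem IsDenjoyPrimitive.integral_of_nonneg {f : ℝ → EReal} {F : ℝ → ℝ}
    (hF : IsDenjoyPrimitive f F) (hf : ∀ᵐ t ∂(volume.restrict (Icc (0 : ℝ) 1)), 0 ≤ f t) :
    IntegrableOn (fun t => (f t).toReal) (Icc 0 1) volume ∧
      ∀ a b : ℝ, 0 ≤ a → a ≤ b → b ≤ 1 → F b - F a = ∫ t in a..b, (f t).toReal := by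
  have hm := hF.monotoneOn hf
  have hae : (fun t => (f t).toReal) =ᵐ[volume.restrict (Icc (0 : ℝ) 1)] deriv F := by
    filter_upwards [hF.2, hm.ae_differentiableAt_Icc] with t ⟨D, hD, hft⟩ ht
    rw [hft, EReal.toReal_coe, hD.eq_deriv ht.2]
  have hint : IntegrableOn (deriv F) (Icc 0 1) := by
    have := MonotoneOn.intervalIntegrable_deriv (f := F) (a := 0) (b := 1)
      (by rwa [uIcc_of_le zero_le_one])
    rwa [intervalIntegrable_iff_integrableOn_Icc_of_le zero_le_one] at this
  refine ⟨hint.congr hae.symm, fun a b ha hab hb => ?_⟩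
  rw [← hF.1.integral_deriv_eq_sub hm ha hab hb, intervalIntegral.integral_of_le hab,
    intervalIntegral.integral_of_le hab]
  exact integral_congr_ae (ae_restrict_of_ae_restrict_of_subset
    (Ioc_subset_Icc_self.trans (Icc_subset_Icc ha hb)) hae.symm)

/-! ### Support functions on the dual space -/

/-- A sublinear function on a dual space that is weak* lower semicontinuous is the support function
of the set of the vectors that it dominates. -/
theorem exists_dominated_vector_of_weakStar_lsc {X : Type*} [NormedAddCommGroup X]
    [NormedSpace ℝ X] (q : (X →L[ℝ] ℝ) → ℝ) (hadd : ∀ φ ψ, q (φ + ψ) ≤ q φ + q ψ)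
    (hsmul : ∀ (a : ℝ) φ, 0 ≤ a → q (a • φ) = a * q φ)
    (hlsc : ∀ φ c, (∀ (s : Finset X) (ε : ℝ), 0 < ε →
      ∃ ψ : X →L[ℝ] ℝ, (∀ x ∈ s, |ψ x - φ x| < ε) ∧ q ψ < c + ε) → q φ ≤ c)
    {φ₀ : X →L[ℝ] ℝ} {c : ℝ} (hc : c < q φ₀) :
    ∃ x : X, (∀ φ : X →L[ℝ] ℝ, φ x ≤ q φ) ∧ c < φ₀ x := by
  set epi : Set (WeakDual ℝ X × ℝ) := {z | q (WeakDual.toStrongDual z.1) ≤ z.2} with hepi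
  have hq0 : q 0 = 0 := by simpa using hsmul 0 0 le_rfl
  have hcone : ∀ z ∈ epi, ∀ a : ℝ, 0 ≤ a → a • z ∈ epi := by
    intro z hz a ha
    have : q (a • WeakDual.toStrongDual z.1) ≤ a * z.2 := by
      rw [hsmul _ _ ha]
      exact mul_le_mul_of_nonneg_left hz ha
    exact this
  have hconv : Convex ℝ epi := by
    intro z hz w hw a b ha hb _
    have h1 := hcone z hz a ha
    have h2 := hcone w hw b hb
    exact (hadd _ _).trans (add_le_add h1 h2)
  have hclosed : IsClosed epi := by
    refine isClosed_of_closure_subset fun z hz => ?_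
    refine hlsc _ _ fun s ε hε => ?_
    have hopen : IsOpen {w : WeakDual ℝ X × ℝ | (∀ x ∈ s, |w.1 x - z.1 x| < ε) ∧ w.2 < z.2 + ε} := by
      refine IsOpen.and ?_ (isOpen_lt (by fun_prop) (by fun_prop))
      have : {w : WeakDual ℝ X × ℝ | ∀ x ∈ s, |w.1 x - z.1 x| < ε} =
          ⋂ x ∈ s, {w : WeakDual ℝ X × ℝ | |w.1 x - z.1 x| < ε} := by
        ext w
        simp
      rw [this]
      refine isOpen_biInter_finset fun x _ => ?_
      have hx : Continuous fun w : WeakDual ℝ X × ℝ => w.1 x :=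
        (WeakDual.eval_continuous x).comp continuous_fst
      exact isOpen_lt (hx.sub continuous_const).abs continuous_const
    obtain ⟨w, ⟨hw1, hw2⟩, hw⟩ := mem_closure_iff.1 hz _ hopen ⟨by simpa using fun _ _ => hε, by simpa⟩
    exact ⟨WeakDual.toStrongDual w.1, hw1, lt_of_le_of_lt hw hw2⟩
  have hnot : (StrongDual.toWeakDual φ₀, c) ∉ epi := not_le.2 hc
  have : LocallyConvexSpace ℝ (WeakDual ℝ X) :=
    inferInstanceAs (LocallyConvexSpace ℝ (WeakBilin (topDualPairing ℝ X)))
  obtain ⟨L, u, hLu, huL⟩ := geometric_hahn_banach_closed_point hconv hclosed hnot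
  -- A weak* continuous functional on the dual is evaluation at a vector of X.
  obtain ⟨x, hx⟩ := LinearMap.dualEmbedding_surjective (topDualPairing ℝ X)
    (L.comp (ContinuousLinearMap.inl ℝ (WeakDual ℝ X) ℝ))
  set β : ℝ := L (0, 1) with hβ
  have hL : ∀ (φ : X →L[ℝ] ℝ) (r : ℝ), L (StrongDual.toWeakDual φ, r) = φ x + r * β := by
    intro φ r
    have h1 : L (StrongDual.toWeakDual φ, 0) = φ x := (DFunLike.congr_fun hx φ).symm
    have h2 : ((StrongDual.toWeakDual φ, r) : WeakDual ℝ X × ℝ) =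
        (StrongDual.toWeakDual φ, 0) + r • (0, 1) := by
      simp
    rw [h2, map_add, map_smul, h1, smul_eq_mul]
  have hu0 : 0 < u := by
    have := hLu 0 (by simp [hepi, hq0])
    simpa using this
  -- The epigraph is a cone: a positive value could be rescaled to equal `u`.
  have hneg : ∀ (φ : X →L[ℝ] ℝ) (r : ℝ), q φ ≤ r → φ x + r * β ≤ 0 := by
    intro φ r hr
    by_contra! hpos
    have hz : ((StrongDual.toWeakDual φ, r) : WeakDual ℝ X × ℝ) ∈ epi := hr
    have := hLu _ (hcone _ hz (u / (φ x + r * β)) (by positivity))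
    rw [map_smul, hL, smul_eq_mul, div_mul_cancel₀ _ hpos.ne'] at this
    exact lt_irrefl _ this
  rw [hL] at huL
  have hβ0 : β < 0 := by
    have h1 := hneg φ₀ _ le_rfl
    by_contra! h
    nlinarith
  have hscale : ∀ φ : X →L[ℝ] ℝ, φ ((-β)⁻¹ • x) = φ x / (-β) := by
    intro φ
    rw [map_smul, smul_eq_mul]
    ring
  -- Dividing by -β normalises the separating hyperplane to be the graph of evaluation at a vector.
  refine ⟨(-β)⁻¹ • x, fun φ => ?_, ?_⟩
  · rw [hscale, div_le_iff₀ (by linarith)]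
    linarith [hneg φ _ le_rfl]
  · rw [hscale, lt_div_iff₀ (by linarith)]
    linarith

theorem add_mul_norm_le_of_forall_mem_ball_le {X : Type*} [NormedAddCommGroup X] [NormedSpace ℝ X]
    {f : X →L[ℝ] ℝ} {x : X} {r u : ℝ} (hr : 0 < r) (h : ∀ a ∈ Metric.ball x r, f a ≤ u) :
    f x + r * ‖f‖ ≤ u := by
  have hfx : f x ≤ u := h x (Metric.mem_ball_self hr)
  by_contra! hcon
  have hlt : (u - f x) / r < ‖f‖ := by
    rw [div_lt_iff₀ hr]
    linarith
  obtain ⟨z, hz1, hz⟩ := f.exists_lt_apply_of_lt_opNorm hlt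
  rw [div_lt_iff₀ hr, Real.norm_eq_abs] at hz
  have hball : ∀ t : ℝ, |t| ≤ r → x + t • z ∈ Metric.ball x r := by
    intro t ht
    rw [mem_ball_iff_norm, add_sub_cancel_left, norm_smul, Real.norm_eq_abs]
    rcases eq_or_ne z 0 with rfl | hz0
    · simpa
    · nlinarith [norm_pos_iff.2 hz0, abs_nonneg t]
  have h1 := h _ (hball r (abs_of_pos hr).le)
  have h2 := h _ (hball (-r) (by rw [abs_neg, abs_of_pos hr]))
  simp only [map_add, map_smul, smul_eq_mul] at h1 h2
  rcases abs_cases (f z) with ⟨h3, -⟩ | ⟨h3, -⟩ <;> rw [h3] at hz <;> nlinarith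

/-- If `p + ε‖·‖` is a support function for every `ε > 0`, then so is `p`. -/
theorem exists_dominated_vector_of_forall_add_norm {X : Type*} [NormedAddCommGroup X]
    [NormedSpace ℝ X] [CompleteSpace X] (p : (X →L[ℝ] ℝ) → ℝ) (hp : ∀ φ, 0 ≤ p φ)
    (h : ∀ ε : ℝ, 0 < ε → ∀ (φ₀ : X →L[ℝ] ℝ) (c : ℝ), c < p φ₀ + ε * ‖φ₀‖ →
      ∃ x : X, (∀ φ : X →L[ℝ] ℝ, φ x ≤ p φ + ε * ‖φ‖) ∧ c < φ₀ x)
    {φ₀ : X →L[ℝ] ℝ} {c : ℝ} (hc : c < p φ₀) :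
    ∃ x : X, (∀ φ : X →L[ℝ] ℝ, φ x ≤ p φ) ∧ c < φ₀ x := by
  set M : ℝ → Set X := fun ε => {x | ∀ φ : X →L[ℝ] ℝ, φ x ≤ p φ + ε * ‖φ‖} with hM
  have hMconv : ∀ ε, Convex ℝ (M ε) := by
    intro ε x hx y hy a b ha hb hab φ
    rw [map_add, map_smul, map_smul, smul_eq_mul, smul_eq_mul]
    calc a * φ x + b * φ y ≤ a * (p φ + ε * ‖φ‖) + b * (p φ + ε * ‖φ‖) :=
          add_le_add (mul_le_mul_of_nonneg_left (hx φ) ha) (mul_le_mul_of_nonneg_left (hy φ) hb)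
      _ = p φ + ε * ‖φ‖ := by rw [← add_mul, hab, one_mul]
  -- If the ball misses `M δ`, a separating `f` satisfies f x + 2ε‖f‖ ≤ u ≤ -p(-f) - δ‖f‖, while `x
  -- ∈ M ε` gives -p(-f) ≤ f x + ε‖f‖. Hence f = 0, which contradicts strict separation from 0 ∈ `M
  -- δ`.
  have hstep : ∀ ε δ : ℝ, 0 < δ → δ < ε → ∀ x ∈ M ε, ∃ y ∈ M δ, dist x y < 2 * ε := by
    intro ε δ hδ hδε x hx
    by_contra! hcon
    have hdisj : Disjoint (Metric.ball x (2 * ε)) (M δ) := by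
      rw [Set.disjoint_left]
      intro y hy hyM
      rw [Metric.mem_ball, dist_comm] at hy
      exact absurd (hcon y hyM) (not_le.2 hy)
    obtain ⟨f, u, hfu, huf⟩ := geometric_hahn_banach_open (convex_ball x (2 * ε)) Metric.isOpen_ball
      (hMconv δ) hdisj
    have h1 := add_mul_norm_le_of_forall_mem_ball_le (by linarith) fun a ha => (hfu a ha).le
    have h2 : p (-f) + δ * ‖-f‖ ≤ -u := by
      by_contra! hlt
      obtain ⟨y, hy, hyu⟩ := h δ hδ (-f) _ hlt
      have := huf y hy
      rw [neg_apply] at hyu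
      linarith
    have h3 := hx (-f)
    rw [norm_neg] at h2 h3
    rw [neg_apply] at h3
    have hf : ‖f‖ ≤ 0 := by nlinarith [norm_nonneg f]
    have hf0 : f = 0 := norm_le_zero_iff.1 hf
    have h4 := hfu x (Metric.mem_ball_self (by linarith))
    have h5 := huf 0 (fun φ => by
      rw [map_zero]
      exact add_nonneg (hp φ) (by positivity))
    simp only [hf0, zero_apply] at h4 h5
    linarith
  -- The steps 2ε/2ⁿ of the iteration below add up to 4ε, so φ₀ loses at most 4ε‖φ₀‖ in the limit.
  obtain ⟨ε, hε, hεc⟩ : ∃ ε : ℝ, 0 < ε ∧ c + 4 * ε * ‖φ₀‖ < p φ₀ := by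
    refine ⟨(p φ₀ - c) / (8 * (‖φ₀‖ + 1)), by have := sub_pos.2 hc; positivity, ?_⟩
    have hn : 0 ≤ ‖φ₀‖ := norm_nonneg _
    have h1 : 4 * ((p φ₀ - c) / (8 * (‖φ₀‖ + 1))) * ‖φ₀‖ =
        (p φ₀ - c) * (‖φ₀‖ / (2 * (‖φ₀‖ + 1))) := by
      field_simp
      ring
    have h2 : ‖φ₀‖ / (2 * (‖φ₀‖ + 1)) < 1 := by
      rw [div_lt_one (by positivity)]
      linarith
    have := mul_lt_mul_of_pos_left h2 (sub_pos.2 hc)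
    linarith
  obtain ⟨x₀, hx₀, hx₀c⟩ := h ε hε φ₀ (c + 4 * ε * ‖φ₀‖)
    (hεc.trans_le (le_add_of_nonneg_right (by positivity)))
  have hpos : ∀ n : ℕ, 0 < ε / 2 ^ n := fun n => by positivity
  have hlt : ∀ n : ℕ, ε / 2 ^ (n + 1) < ε / 2 ^ n := fun n => by
    rw [pow_succ, ← div_div]
    exact half_lt_self (hpos n)
  choose! next hnextM hnextd using fun n => hstep _ _ (hpos (n + 1)) (hlt n)
  let y : ℕ → X := fun n => Nat.rec x₀ (fun n x => next n x) n
  have hyM : ∀ n, y n ∈ M (ε / 2 ^ n) := by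
    intro n
    induction n with
    | zero =>
      rw [pow_zero, div_one]
      exact hx₀
    | succ n ih => exact hnextM n _ ih
  have hyd : ∀ n, dist (y n) (y (n + 1)) ≤ 4 * ε / 2 / 2 ^ n := by
    intro n
    refine (hnextd n _ (hyM n)).le.trans (le_of_eq ?_)
    ring
  obtain ⟨x, hx⟩ := cauchySeq_tendsto_of_complete (cauchySeq_of_le_geometric_two hyd)
  have hdist : dist x₀ x ≤ 4 * ε := dist_le_of_le_geometric_two_of_tendsto₀ hyd hx
  refine ⟨x, fun φ => ?_, ?_⟩
  · have h1 : Tendsto (fun n => φ (y n)) atTop (𝓝 (φ x)) := (φ.continuous.tendsto x).comp hx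
    have h2 : Tendsto (fun n : ℕ => p φ + ε / 2 ^ n * ‖φ‖) atTop (𝓝 (p φ + 0 * ‖φ‖)) := by
      refine tendsto_const_nhds.add (Tendsto.mul_const _ ?_)
      have := tendsto_pow_atTop_nhds_zero_of_lt_one (r := (1 / 2 : ℝ)) (by norm_num) (by norm_num)
      simpa [div_eq_mul_inv] using this.const_mul ε
    rw [zero_mul, add_zero] at h2
    exact le_of_tendsto_of_tendsto' h1 h2 fun n => hyM n φ
  · have h1 : |φ₀ (x₀ - x)| ≤ ‖φ₀‖ * (4 * ε) := by
      rw [← Real.norm_eq_abs]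
      refine (φ₀.le_opNorm _).trans (mul_le_mul_of_nonneg_left ?_ (norm_nonneg _))
      rwa [← dist_eq_norm]
    rw [map_sub] at h1
    linarith [(abs_le.1 h1).2]

/-! ### A Komlós type selection -/

theorem Real.add_exp_neg_le_add_exp_neg {a b : ℝ} (ha : 0 ≤ a) (hab : a ≤ b) :
    a + Real.exp (-a) ≤ b + Real.exp (-b) := by
  have h1 : Real.exp (-b) = Real.exp (-a) * Real.exp (-(b - a)) := by
    rw [← Real.exp_add]
    congr 1
    ring
  have h2 : 1 - (b - a) ≤ Real.exp (-(b - a)) := by linarith [Real.add_one_le_exp (-(b - a))]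
  have h3 : Real.exp (-a) ≤ 1 := Real.exp_le_one_iff.2 (by linarith)
  rw [h1]
  nlinarith [Real.exp_pos (-a)]

/-- For θ(s) = s + exp(-s), the midpoint convexity gap at a, b is exactly the square on the left;
the linear term makes θ nondecreasing on [0, ∞), which allows m below the midpoint. Near-minimality
for ∫ θ thus becomes closeness in L². -/
theorem Real.sq_sub_exp_neg_half_le {a b m : ℝ} (hm : 0 ≤ m) (hmab : m ≤ (a + b) / 2) :
    (Real.exp (-a / 2) - Real.exp (-b / 2)) ^ 2 ≤
      (a + Real.exp (-a)) + (b + Real.exp (-b)) - 2 * (m + Real.exp (-m)) := by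
  have h1 := Real.add_exp_neg_le_add_exp_neg hm hmab
  have ha : Real.exp (-a) = Real.exp (-a / 2) ^ 2 := by
    rw [← Real.exp_nat_mul]
    congr 1
    push_cast
    ring
  have hb : Real.exp (-b) = Real.exp (-b / 2) ^ 2 := by
    rw [← Real.exp_nat_mul]
    congr 1
    push_cast
    ring
  have hab : Real.exp (-((a + b) / 2)) = Real.exp (-a / 2) * Real.exp (-b / 2) := by
    rw [← Real.exp_add]
    congr 1
    ring
  rw [hab] at h1
  rw [ha, hb]
  linarith

/-- A Komlós type selection: from a decreasing sequence of convex sets on which a convex family of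
nonnegative integrable functions is bounded in `L¹`, one can select elements along which the
functions converge almost everywhere in `[0, ∞]`. -/
theorem exists_seq_ae_tendsto_exp_neg {Ω E : Type*} [MeasurableSpace Ω] {ν : Measure Ω}
    [IsFiniteMeasure ν] [AddCommGroup E] [Module ℝ E] (g : E → Ω → ℝ) (C : ℕ → Set E)
    (hC : Antitone C) (hconv : ∀ n, Convex ℝ (C n)) (hne : ∀ n, (C n).Nonempty)
    (hpos : ∀ x, ∀ᵐ t ∂ν, 0 ≤ g x t) (hint : ∀ x, Integrable (g x) ν)
    (hmid : ∀ x y, ∀ᵐ t ∂ν, g ((1 / 2 : ℝ) • x + (1 / 2 : ℝ) • y) t ≤ (g x t + g y t) / 2)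
    {K : ℝ} (hK : ∀ x ∈ C 0, ∫ t, g x t ∂ν ≤ K) :
    ∃ (ψ : ℕ → E) (u : Ω → ℝ), (∀ n, ψ n ∈ C n) ∧
      ∀ᵐ t ∂ν, Tendsto (fun n => Real.exp (-g (ψ n) t / 2)) atTop (𝓝 (u t)) := by
  have hmeas : ∀ x, AEStronglyMeasurable (fun t => Real.exp (-g x t)) ν := fun x =>
    Real.continuous_exp.comp_aestronglyMeasurable (hint x).aestronglyMeasurable.neg
  have hmeas2 : ∀ x, AEStronglyMeasurable (fun t => Real.exp (-g x t / 2)) ν := fun x => by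
    have h : Continuous fun s : ℝ => Real.exp (-s / 2) := by fun_prop
    exact h.comp_aestronglyMeasurable (hint x).aestronglyMeasurable
  have hexp : ∀ x, Integrable (fun t => Real.exp (-g x t)) ν := fun x => by
    refine Integrable.of_bound (hmeas x) 1 ?_
    filter_upwards [hpos x] with t ht
    rw [Real.norm_eq_abs, Real.abs_exp]
    exact Real.exp_le_one_iff.2 (by linarith)
  have hLp : ∀ x, MemLp (fun t => Real.exp (-g x t / 2)) 2 ν := fun x => by
    refine MemLp.of_bound (hmeas2 x) 1 ?_
    filter_upwards [hpos x] with t ht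
    rw [Real.norm_eq_abs, Real.abs_exp]
    exact Real.exp_le_one_iff.2 (by linarith)
  have hθ : ∀ x, Integrable (fun t => g x t + Real.exp (-g x t)) ν := fun x => (hint x).add (hexp x)
  set Φ : E → ℝ := fun x => ∫ t, (g x t + Real.exp (-g x t)) ∂ν with hΦ
  have hΦ0 : ∀ x, 0 ≤ Φ x := fun x => by
    refine integral_nonneg_of_ae ?_
    filter_upwards [hpos x] with t ht
    exact add_nonneg ht (Real.exp_pos _).le
  have hΦK : ∀ x ∈ C 0, Φ x ≤ K + ν.real univ := by
    intro x hx
    rw [hΦ]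
    simp only
    rw [integral_add (hint x) (hexp x)]
    refine add_le_add (hK x hx) ?_
    calc ∫ t, Real.exp (-g x t) ∂ν ≤ ∫ _, (1 : ℝ) ∂ν := by
          refine integral_mono_ae (hexp x) (integrable_const _) ?_
          filter_upwards [hpos x] with t ht
          exact Real.exp_le_one_iff.2 (by linarith)
      _ = ν.real univ := by simp
  set I : ℕ → ℝ := fun n => sInf (Φ '' C n) with hI
  have hbdd : ∀ n, BddBelow (Φ '' C n) := fun n => ⟨0, by
    rintro _ ⟨x, -, rfl⟩
    exact hΦ0 x⟩
  have hIle : ∀ n, ∀ x ∈ C n, I n ≤ Φ x := fun n x hx => csInf_le (hbdd n) ⟨x, hx, rfl⟩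
  have hImono : Monotone I := fun n m hnm =>
    csInf_le_csInf (hbdd n) ((hne m).image _) (image_mono (hC hnm))
  have hIbdd : BddAbove (range I) := ⟨K + ν.real univ, by
    rintro _ ⟨n, rfl⟩
    obtain ⟨x, hx⟩ := hne n
    exact (hIle n x hx).trans (hΦK x (hC (Nat.zero_le n) hx))⟩
  have hIlim := tendsto_atTop_ciSup hImono hIbdd
  set J : ℝ := ⨆ n, I n with hJ
  have hsel : ∀ n : ℕ, ∃ x ∈ C n, Φ x < I n + 1 / ((n : ℝ) + 1) := by
    intro n
    obtain ⟨_, ⟨x, hx, rfl⟩, hlt⟩ := exists_lt_of_csInf_lt ((hne n).image Φ)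
      (lt_add_of_pos_right (I n) (by positivity : 0 < 1 / ((n : ℝ) + 1)))
    exact ⟨x, hx, hlt⟩
  choose ψ hψC hψ using hsel
  -- The midpoint of ψ n and ψ m lies in `C n`, so `Φ` there is at least `I n`, while both ends are
  -- near-minimal with `I m ≤ J`.
  have hkey : ∀ n m, n ≤ m → ∫ t, (Real.exp (-g (ψ n) t / 2) - Real.exp (-g (ψ m) t / 2)) ^ 2 ∂ν ≤
      J - I n + 2 * (1 / ((n : ℝ) + 1)) := by
    intro n m hnm
    set z : E := (1 / 2 : ℝ) • ψ n + (1 / 2 : ℝ) • ψ m with hz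
    have hzC : z ∈ C n :=
      hconv n (hψC n) (hC hnm (hψC m)) (by norm_num) (by norm_num) (by norm_num)
    have h1 : ∫ t, (Real.exp (-g (ψ n) t / 2) - Real.exp (-g (ψ m) t / 2)) ^ 2 ∂ν ≤
        Φ (ψ n) + Φ (ψ m) - 2 * Φ z := by
      have hsum : Integrable (fun t => (g (ψ n) t + Real.exp (-g (ψ n) t)) +
          (g (ψ m) t + Real.exp (-g (ψ m) t))) ν := (hθ _).add (hθ _)
      rw [hΦ]
      simp only
      rw [← integral_add (hθ _) (hθ _), ← integral_const_mul,
        ← integral_sub hsum ((hθ z).const_mul 2)]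
      refine integral_mono_ae ((hLp _).sub (hLp _)).integrable_sq
        (hsum.sub ((hθ z).const_mul 2)) ?_
      filter_upwards [hpos z, hmid (ψ n) (ψ m)] with t ht1 ht2
      exact Real.sq_sub_exp_neg_half_le ht1 ht2
    have h2 := hψ n
    have h3 := hψ m
    have h4 := hIle n z hzC
    have h5 : I m ≤ J := le_ciSup hIbdd m
    have h6 : 1 / ((m : ℝ) + 1) ≤ 1 / ((n : ℝ) + 1) :=
      one_div_le_one_div_of_le (by positivity) (by exact_mod_cast Nat.succ_le_succ hnm)
    linarith
  set U : ℕ → Lp ℝ 2 ν := fun n => (hLp (ψ n)).toLp with hU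
  have hdist : ∀ n m, n ≤ m → dist (U n) (U m) ≤
      Real.sqrt (J - I n + 2 * (1 / ((n : ℝ) + 1))) := by
    intro n m hnm
    refine Real.le_sqrt_of_sq_le ?_
    refine le_trans (le_of_eq ?_) (hkey n m hnm)
    rw [dist_eq_norm, ← real_inner_self_eq_norm_sq, L2.inner_def]
    refine integral_congr_ae ?_
    filter_upwards [Lp.coeFn_sub (U n) (U m), (hLp (ψ n)).coeFn_toLp, (hLp (ψ m)).coeFn_toLp]
      with t h1 h2 h3
    rw [h1, Pi.sub_apply, h2, h3]
    simp [sq]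
  have hlim0 : Tendsto (fun n : ℕ => Real.sqrt (J - I n + 2 * (1 / ((n : ℝ) + 1)))) atTop (𝓝 0) := by
    have h1 : Tendsto (fun n : ℕ => J - I n + 2 * (1 / ((n : ℝ) + 1))) atTop (𝓝 (J - J + 2 * 0)) :=
      (tendsto_const_nhds.sub hIlim).add (tendsto_one_div_add_atTop_nhds_zero_nat.const_mul 2)
    simpa using h1.sqrt
  obtain ⟨V, hV⟩ := cauchySeq_tendsto_of_complete (cauchySeq_of_le_tendsto_0' _ hdist hlim0)
  obtain ⟨ns, hns, hae⟩ := (tendstoInMeasure_of_tendsto_Lp hV).exists_seq_tendsto_ae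
  refine ⟨fun k => ψ (ns k), V, fun k => hC hns.le_apply (hψC _), ?_⟩
  have hall : ∀ᵐ t ∂ν, ∀ k, U (ns k) t = Real.exp (-g (ψ (ns k)) t / 2) :=
    ae_all_iff.2 fun k => (hLp _).coeFn_toLp
  filter_upwards [hae, hall] with t h1 h2
  simpa only [h2] using h1

/-! ### Support functions and weak* lower semicontinuity of their integrals -/

section SupportFunction

variable {X : Type*} [NormedAddCommGroup X] [NormedSpace ℝ X]

theorem supportFun_le_coe_iff {φ : X →L[ℝ] ℝ} {C : Set X} {r : ℝ} :
    supportFun φ C ≤ (r : EReal) ↔ ∀ x ∈ C, φ x ≤ r := by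
  simp [supportFun]

theorem coe_lt_supportFun_iff {φ : X →L[ℝ] ℝ} {C : Set X} {r : ℝ} :
    (r : EReal) < supportFun φ C ↔ ∃ x ∈ C, r < φ x := by
  simp [supportFun, lt_iSup_iff]

theorem apply_le_of_supportFun_eq {φ : X →L[ℝ] ℝ} {C : Set X} {r : ℝ}
    (h : supportFun φ C = (r : EReal)) {x : X} (hx : x ∈ C) : φ x ≤ r :=
  supportFun_le_coe_iff.1 h.le x hx

theorem le_of_supportFun_eq {φ : X →L[ℝ] ℝ} {C : Set X} {r s : ℝ}
    (h : supportFun φ C = (r : EReal)) (hs : ∀ x ∈ C, φ x ≤ s) : r ≤ s := by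
  have := supportFun_le_coe_iff.2 hs
  rw [h] at this
  exact_mod_cast this

theorem supportFun_eq_coe {φ : X →L[ℝ] ℝ} {C : Set X} {r : ℝ} (h1 : ∀ x ∈ C, φ x ≤ r)
    (h2 : ∀ c < r, ∃ x ∈ C, c < φ x) : supportFun φ C = (r : EReal) := by
  refine le_antisymm (supportFun_le_coe_iff.2 h1) ?_
  refine le_of_not_gt fun hlt => ?_
  obtain ⟨d, hd1, hd2⟩ := EReal.lt_iff_exists_real_btwn.1 hlt
  exact lt_asymm hd1 (coe_lt_supportFun_iff.2 (h2 d (by exact_mod_cast hd2)))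

/-- A sequence in the unit ball that norms φ₀ suffices. Such countable tests replace separability of
X. -/
theorem exists_countable_norm_le_of_eqOn (φ₀ : X →L[ℝ] ℝ) :
    ∃ D : Set X, D.Countable ∧ ∀ φ : X →L[ℝ] ℝ, (∀ x ∈ D, φ x = φ₀ x) → ‖φ₀‖ ≤ ‖φ‖ := by
  have h : ∀ n : ℕ, ∃ z : X, ‖z‖ < 1 ∧ ‖φ₀‖ - 1 / ((n : ℝ) + 1) < ‖φ₀ z‖ := fun n =>
    φ₀.exists_lt_apply_of_lt_opNorm (sub_lt_self _ (by positivity))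
  choose z hz1 hz using h
  refine ⟨range z, countable_range z, fun φ hφ => ?_⟩
  have hlim : Tendsto (fun n : ℕ => ‖φ₀‖ - 1 / ((n : ℝ) + 1)) atTop (𝓝 ‖φ₀‖) := by
    simpa using (tendsto_one_div_add_atTop_nhds_zero_nat (𝕜 := ℝ)).const_sub _
  refine le_of_tendsto' hlim fun n => (hz n).le.trans ?_
  rw [← hφ _ ⟨n, rfl⟩]
  exact φ.unit_le_opNorm _ (hz1 n).le

/-- The countable set is a maximising sequence for φ₀ in `C`. -/
theorem exists_countable_le_of_supportFun_eq {C : Set X} {φ₀ : X →L[ℝ] ℝ} {r : ℝ}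
    (h : supportFun φ₀ C = (r : EReal)) :
    ∃ D : Set X, D.Countable ∧ ∀ (φ : X →L[ℝ] ℝ) (s : ℝ), supportFun φ C = (s : EReal) →
      (∀ x ∈ D, φ x = φ₀ x) → r ≤ s := by
  have hx : ∀ n : ℕ, ∃ x ∈ C, r - 1 / ((n : ℝ) + 1) < φ₀ x := fun n => by
    rw [← coe_lt_supportFun_iff, h]
    exact_mod_cast sub_lt_self _ (by positivity)
  choose x hxC hx using hx
  refine ⟨range x, countable_range x, fun φ s hs hφ => ?_⟩
  have hlim : Tendsto (fun n : ℕ => r - 1 / ((n : ℝ) + 1)) atTop (𝓝 r) := by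
    simpa using (tendsto_one_div_add_atTop_nhds_zero_nat (𝕜 := ℝ)).const_sub _
  refine le_of_tendsto' hlim fun n => (hx n).le.trans ?_
  rw [← hφ _ ⟨n, rfl⟩]
  exact apply_le_of_supportFun_eq hs (hxC n)

variable {Ω : Type*} [MeasurableSpace Ω] {ν : Measure Ω} {Γ : Ω → Set X}

/-- The real valued function `t ↦ s(φ, Γ(t))`. -/
noncomputable def scalarSupport (Γ : Ω → Set X) (φ : X →L[ℝ] ℝ) (t : Ω) : ℝ :=
  (supportFun φ (Γ t)).toReal

theorem scalarSupport_add_le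
    (hΓ : ∀ φ : X →L[ℝ] ℝ, ∀ᵐ t ∂ν, supportFun φ (Γ t) = (scalarSupport Γ φ t : EReal))
    (φ ψ : X →L[ℝ] ℝ) :
    ∀ᵐ t ∂ν, scalarSupport Γ (φ + ψ) t ≤ scalarSupport Γ φ t + scalarSupport Γ ψ t := by
  filter_upwards [hΓ φ, hΓ ψ, hΓ (φ + ψ)] with t h1 h2 h3
  exact le_of_supportFun_eq h3 fun x hx => by
    rw [add_apply]
    exact add_le_add (apply_le_of_supportFun_eq h1 hx) (apply_le_of_supportFun_eq h2 hx)

theorem scalarSupport_smul_le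
    (hΓ : ∀ φ : X →L[ℝ] ℝ, ∀ᵐ t ∂ν, supportFun φ (Γ t) = (scalarSupport Γ φ t : EReal))
    (φ : X →L[ℝ] ℝ) {a : ℝ} (ha : 0 ≤ a) :
    ∀ᵐ t ∂ν, scalarSupport Γ (a • φ) t ≤ a * scalarSupport Γ φ t := by
  filter_upwards [hΓ φ, hΓ (a • φ)] with t h1 h2
  exact le_of_supportFun_eq h2 fun x hx => by
    rw [smul_apply, smul_eq_mul]
    exact mul_le_mul_of_nonneg_left (apply_le_of_supportFun_eq h1 hx) ha

theorem scalarSupport_midpoint_le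
    (hΓ : ∀ φ : X →L[ℝ] ℝ, ∀ᵐ t ∂ν, supportFun φ (Γ t) = (scalarSupport Γ φ t : EReal))
    (φ ψ : X →L[ℝ] ℝ) :
    ∀ᵐ t ∂ν, scalarSupport Γ ((1 / 2 : ℝ) • φ + (1 / 2 : ℝ) • ψ) t ≤
      (scalarSupport Γ φ t + scalarSupport Γ ψ t) / 2 := by
  filter_upwards [scalarSupport_add_le hΓ ((1 / 2 : ℝ) • φ) ((1 / 2 : ℝ) • ψ),
    scalarSupport_smul_le hΓ φ (a := 1 / 2) (by norm_num),
    scalarSupport_smul_le hΓ ψ (a := 1 / 2) (by norm_num)] with t h1 h2 h3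
  linarith

theorem integral_scalarSupport_add_le
    (hΓ : ∀ φ : X →L[ℝ] ℝ, ∀ᵐ t ∂ν, supportFun φ (Γ t) = (scalarSupport Γ φ t : EReal))
    (hint : ∀ φ : X →L[ℝ] ℝ, Integrable (scalarSupport Γ φ) ν) (φ ψ : X →L[ℝ] ℝ) :
    ∫ t, scalarSupport Γ (φ + ψ) t ∂ν ≤
      ∫ t, scalarSupport Γ φ t ∂ν + ∫ t, scalarSupport Γ ψ t ∂ν := by
  rw [← integral_add (hint φ) (hint ψ)]
  exact integral_mono_ae (hint _) ((hint φ).add (hint ψ)) (scalarSupport_add_le hΓ φ ψ)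

theorem integral_scalarSupport_smul_le
    (hΓ : ∀ φ : X →L[ℝ] ℝ, ∀ᵐ t ∂ν, supportFun φ (Γ t) = (scalarSupport Γ φ t : EReal))
    (hint : ∀ φ : X →L[ℝ] ℝ, Integrable (scalarSupport Γ φ) ν) (φ : X →L[ℝ] ℝ) {a : ℝ}
    (ha : 0 ≤ a) :
    ∫ t, scalarSupport Γ (a • φ) t ∂ν ≤ a * ∫ t, scalarSupport Γ φ t ∂ν := by
  rw [← integral_const_mul]
  exact integral_mono_ae (hint _) ((hint φ).const_mul a) (scalarSupport_smul_le hΓ φ ha)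

theorem integral_scalarSupport_smul
    (hΓ : ∀ φ : X →L[ℝ] ℝ, ∀ᵐ t ∂ν, supportFun φ (Γ t) = (scalarSupport Γ φ t : EReal))
    (hpos : ∀ φ : X →L[ℝ] ℝ, ∀ᵐ t ∂ν, 0 ≤ scalarSupport Γ φ t)
    (hint : ∀ φ : X →L[ℝ] ℝ, Integrable (scalarSupport Γ φ) ν) (φ : X →L[ℝ] ℝ) {a : ℝ}
    (ha : 0 ≤ a) :
    ∫ t, scalarSupport Γ (a • φ) t ∂ν = a * ∫ t, scalarSupport Γ φ t ∂ν := by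
  refine le_antisymm (integral_scalarSupport_smul_le hΓ hint φ ha) ?_
  rcases ha.eq_or_lt with rfl | ha
  · rw [zero_mul]
    exact integral_nonneg_of_ae (hpos _)
  · have h := integral_scalarSupport_smul_le hΓ hint (a • φ) (inv_nonneg.2 ha.le)
    rwa [inv_smul_smul₀ ha.ne', ← div_eq_inv_mul, le_div_iff₀' ha] at h

/-- Weak* cluster points of `φ ↦ s(φ, Γ)`: Fatou's lemma along a sequence of functionals. -/
theorem integral_scalarSupport_le_of_tendsto_ultrafilter
    (hΓ : ∀ φ : X →L[ℝ] ℝ, ∀ᵐ t ∂ν, supportFun φ (Γ t) = (scalarSupport Γ φ t : EReal))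
    (hpos : ∀ φ : X →L[ℝ] ℝ, ∀ᵐ t ∂ν, 0 ≤ scalarSupport Γ φ t)
    (hint : ∀ φ : X →L[ℝ] ℝ, Integrable (scalarSupport Γ φ) ν)
    {ψ : ℕ → X →L[ℝ] ℝ} {u : Ω → ℝ}
    (hu : ∀ᵐ t ∂ν, Tendsto (fun n => Real.exp (-scalarSupport Γ (ψ n) t / 2)) atTop (𝓝 (u t)))
    {U : Ultrafilter ℕ} (hU : (U : Filter ℕ) ≤ atTop) {φ : X →L[ℝ] ℝ}
    (hφ : ∀ x, Tendsto (fun n => ψ n x) U (𝓝 (φ x))) {b : ℕ → ℝ} {β : ℝ}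
    (hb : ∀ n, ∫ t, scalarSupport Γ (ψ n) t ∂ν ≤ b n) (hβ : Tendsto b atTop (𝓝 β)) :
    ∫ t, scalarSupport Γ φ t ∂ν ≤ β := by
  have hnn : ∀ χ, 0 ≤ ∫ t, scalarSupport Γ χ t ∂ν := fun χ => integral_nonneg_of_ae (hpos χ)
  have hβ0 : 0 ≤ β := ge_of_tendsto' hβ fun n => (hnn (ψ n)).trans (hb n)
  -- A vector of `Γ t` nearly maximising φ bounds s(ψ n, Γ t) from below only along `U`. Convergence
  -- of the exponentials along `atTop` carries the bound to all large n, so Fatou's lemma for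
  -- sequences applies.
  have hpt : ∀ᵐ t ∂ν, ENNReal.ofReal (scalarSupport Γ φ t) ≤
      liminf (fun n => ENNReal.ofReal (scalarSupport Γ (ψ n) t)) atTop := by
    filter_upwards [hu, hΓ φ, hpos φ, ae_all_iff.2 fun n => hΓ (ψ n)] with t h1 h2 h3 h4
    refine le_of_forall_lt fun d hd => ?_
    obtain ⟨e, hde, hed⟩ := exists_between hd
    have he : e ≠ ⊤ := ne_top_of_lt hed
    obtain ⟨r, hr1, hr2⟩ := exists_between ((ENNReal.lt_ofReal_iff_toReal_lt he).1 hed)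
    obtain ⟨x, hx, hrx⟩ := coe_lt_supportFun_iff.1 (h2 ▸ (EReal.coe_lt_coe_iff.2 hr2) :
      (r : EReal) < supportFun φ (Γ t))
    have hur : u t ≤ Real.exp (-r / 2) := by
      refine le_of_tendsto (h1.mono_left hU) ?_
      filter_upwards [(hφ x).eventually (lt_mem_nhds hrx)] with n hn
      have := apply_le_of_supportFun_eq (h4 n) hx
      exact Real.exp_le_exp.2 (by linarith)
    have hue : u t < Real.exp (-e.toReal / 2) :=
      hur.trans_lt (Real.exp_lt_exp.2 (by linarith))
    refine hde.trans_le (le_liminf_of_le (by isBoundedDefault) ?_)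
    filter_upwards [h1.eventually (gt_mem_nhds hue)] with n hn
    have := Real.exp_lt_exp.1 hn
    rw [← ENNReal.ofReal_toReal he]
    exact ENNReal.ofReal_le_ofReal (by linarith)
  have hofReal : ∀ χ, ENNReal.ofReal (∫ t, scalarSupport Γ χ t ∂ν) =
      ∫⁻ t, ENNReal.ofReal (scalarSupport Γ χ t) ∂ν := fun χ =>
    ofReal_integral_eq_lintegral_ofReal (hint χ) (hpos χ)
  rw [← ENNReal.ofReal_le_ofReal_iff hβ0, hofReal]
  calc ∫⁻ t, ENNReal.ofReal (scalarSupport Γ φ t) ∂ν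
      ≤ ∫⁻ t, liminf (fun n => ENNReal.ofReal (scalarSupport Γ (ψ n) t)) atTop ∂ν :=
        lintegral_mono_ae hpt
    _ ≤ liminf (fun n => ∫⁻ t, ENNReal.ofReal (scalarSupport Γ (ψ n) t) ∂ν) atTop :=
        lintegral_liminf_le' fun n => (hint (ψ n)).aemeasurable.ennreal_ofReal
    _ ≤ liminf (fun n => ENNReal.ofReal (b n)) atTop := by
        refine liminf_le_liminf (Eventually.of_forall fun n => ?_)
        rw [← hofReal]
        exact ENNReal.ofReal_le_ofReal (hb n)
    _ = ENNReal.ofReal β := ((ENNReal.continuous_ofReal.tendsto β).comp hβ).liminf_eq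

/-- Weak* lower semicontinuity of `φ ↦ ∫ s(φ, Γ) + ε‖φ‖` when, for each `φ₀`, the function
`s(φ₀, Γ)` is controlled by the values of `φ₀` on a countable set. -/
theorem integral_scalarSupport_add_norm_le [IsFiniteMeasure ν]
    (hΓ : ∀ φ : X →L[ℝ] ℝ, ∀ᵐ t ∂ν, supportFun φ (Γ t) = (scalarSupport Γ φ t : EReal))
    (hpos : ∀ φ : X →L[ℝ] ℝ, ∀ᵐ t ∂ν, 0 ≤ scalarSupport Γ φ t)
    (hint : ∀ φ : X →L[ℝ] ℝ, Integrable (scalarSupport Γ φ) ν)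
    (hdet : ∀ φ₀ : X →L[ℝ] ℝ, ∃ D : Set X, D.Countable ∧ ∀ φ : X →L[ℝ] ℝ,
      (∀ x ∈ D, φ x = φ₀ x) → ∫ t, scalarSupport Γ φ₀ t ∂ν ≤ ∫ t, scalarSupport Γ φ t ∂ν)
    {ε : ℝ} (hε : 0 < ε) {φ₀ : X →L[ℝ] ℝ} {c : ℝ}
    (h : ∀ (s : Finset X) (η : ℝ), 0 < η → ∃ ψ : X →L[ℝ] ℝ, (∀ x ∈ s, |ψ x - φ₀ x| < η) ∧
      ∫ t, scalarSupport Γ ψ t ∂ν + ε * ‖ψ‖ < c + η) :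
    ∫ t, scalarSupport Γ φ₀ t ∂ν + ε * ‖φ₀‖ ≤ c := by
  obtain ⟨D₁, hD₁, hdet⟩ := hdet φ₀
  obtain ⟨D₂, hD₂, hnorm⟩ := exists_countable_norm_le_of_eqOn φ₀
  obtain ⟨y, hy⟩ := ((hD₁.union hD₂).insert 0).exists_eq_range (insert_nonempty _ _)
  have hnn : ∀ χ, 0 ≤ ∫ t, scalarSupport Γ χ t ∂ν := fun χ => integral_nonneg_of_ae (hpos χ)
  -- Only the values on the countable test set are controlled, so a cluster point need not be φ₀ but
  -- agrees with it there.
  set C : ℕ → Set (X →L[ℝ] ℝ) := fun n =>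
    {ψ | (∀ k ≤ n, |ψ (y k) - φ₀ (y k)| ≤ 1 / ((n : ℝ) + 1)) ∧
      ∫ t, scalarSupport Γ ψ t ∂ν + ε * ‖ψ‖ ≤ c + 1 / ((n : ℝ) + 1)} with hC
  have hCanti : Antitone C := by
    intro n m hnm ψ hψ
    have h6 : 1 / ((m : ℝ) + 1) ≤ 1 / ((n : ℝ) + 1) :=
      one_div_le_one_div_of_le (by positivity) (by exact_mod_cast Nat.succ_le_succ hnm)
    exact ⟨fun k hk => (hψ.1 k (hk.trans hnm)).trans h6, hψ.2.trans (by linarith)⟩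
  have hCne : ∀ n, (C n).Nonempty := by
    intro n
    classical
    obtain ⟨ψ, h1, h2⟩ := h ((Finset.range (n + 1)).image y) (1 / ((n : ℝ) + 1)) (by positivity)
    exact ⟨ψ, fun k hk => (h1 _ (Finset.mem_image_of_mem y
      (Finset.mem_range.2 (Nat.lt_succ_of_le hk)))).le, h2.le⟩
  have hCconv : ∀ n, Convex ℝ (C n) := by
    intro n ψ hψ χ hχ a b ha hb hab
    refine ⟨fun k hk => ?_, ?_⟩
    · have h1 : (a • ψ + b • χ) (y k) - φ₀ (y k) =
          a * (ψ (y k) - φ₀ (y k)) + b * (χ (y k) - φ₀ (y k)) := by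
        simp only [add_apply, smul_apply, smul_eq_mul]
        linear_combination φ₀ (y k) * hab
      rw [h1]
      refine (abs_add_le _ _).trans ?_
      rw [abs_mul, abs_mul, abs_of_nonneg ha, abs_of_nonneg hb]
      calc _ ≤ a * (1 / ((n : ℝ) + 1)) + b * (1 / ((n : ℝ) + 1)) :=
            add_le_add (mul_le_mul_of_nonneg_left (hψ.1 k hk) ha)
              (mul_le_mul_of_nonneg_left (hχ.1 k hk) hb)
        _ = _ := by rw [← add_mul, hab, one_mul]
    · have h1 := integral_scalarSupport_add_le hΓ hint (a • ψ) (b • χ)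
      have h2 := integral_scalarSupport_smul_le hΓ hint ψ ha
      have h3 := integral_scalarSupport_smul_le hΓ hint χ hb
      have h4 : ‖a • ψ + b • χ‖ ≤ a * ‖ψ‖ + b * ‖χ‖ := by
        refine (norm_add_le _ _).trans ?_
        rw [norm_smul, norm_smul, Real.norm_of_nonneg ha, Real.norm_of_nonneg hb]
      have h5 := mul_le_mul_of_nonneg_left h4 hε.le
      have h6 := mul_le_mul_of_nonneg_left hψ.2 ha
      have h7 := mul_le_mul_of_nonneg_left hχ.2 hb
      have h8 : a * (c + 1 / ((n : ℝ) + 1)) + b * (c + 1 / ((n : ℝ) + 1)) =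
          c + 1 / ((n : ℝ) + 1) := by rw [← add_mul, hab, one_mul]
      linarith
  have hone : ∀ n : ℕ, 1 / ((n : ℝ) + 1) ≤ 1 := fun n => by
    rw [div_le_one (by positivity)]
    linarith [(Nat.cast_nonneg n : (0 : ℝ) ≤ n)]
  obtain ⟨ψ, u, hψC, hu⟩ := exists_seq_ae_tendsto_exp_neg (ν := ν) (scalarSupport Γ) C hCanti hCconv
    hCne hpos hint (scalarSupport_midpoint_le hΓ) (K := c + 1) (fun χ hχ => by
      have h1 := hχ.2
      have h2 : 0 ≤ ε * ‖χ‖ := by positivity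
      have h3 := hone 0
      linarith)
  have hψnorm : ∀ n, ‖ψ n‖ ≤ (c + 1) / ε := fun n => by
    rw [le_div_iff₀ hε]
    have h1 := (hψC n).2
    have h2 := hnn (ψ n)
    have h3 := hone n
    linarith
  -- Convergence of the norms to `a` lets Fatou's lemma yield the bound c - εa for the integral
  -- alone; `a` dominates ‖φ‖, hence ‖φ₀‖.
  obtain ⟨a, -, ns, hns, ha⟩ := isCompact_Icc.tendsto_subseq
    (x := fun n => ‖ψ n‖) (s := Icc 0 ((c + 1) / ε)) fun n => ⟨norm_nonneg _, hψnorm n⟩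
  set U : Ultrafilter ℕ := Ultrafilter.of atTop with hUdef
  have hU : (U : Filter ℕ) ≤ atTop := Ultrafilter.of_le atTop
  obtain ⟨φ', -, hφ'⟩ := (WeakDual.isCompact_closedBall (0 : StrongDual ℝ X)
    ((c + 1) / ε)).ultrafilter_le_nhds'
    (U.map fun n => StrongDual.toWeakDual (ψ (ns n))) (by
      refine Filter.mem_map.2 (Filter.univ_mem' fun n => ?_)
      simpa using hψnorm (ns n))
  set φ : X →L[ℝ] ℝ := WeakDual.toStrongDual φ' with hφdef
  have hφ : ∀ x, Tendsto (fun n => ψ (ns n) x) U (𝓝 (φ x)) := fun x =>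
    ((WeakDual.eval_continuous x).tendsto φ').comp hφ'
  have hφa : ‖φ‖ ≤ a := by
    refine φ.opNorm_le_bound (ge_of_tendsto' ha fun n => norm_nonneg _) fun x => ?_
    exact le_of_tendsto_of_tendsto' (hφ x).norm ((ha.mono_left hU).mul_const ‖x‖)
      fun n => (ψ (ns n)).le_opNorm x
  have hφy : ∀ x ∈ D₁ ∪ D₂, φ x = φ₀ x := by
    intro x hx
    obtain ⟨k, rfl⟩ : x ∈ range y := hy ▸ mem_insert_of_mem 0 hx
    refine tendsto_nhds_unique (hφ (y k)) (Tendsto.mono_left ?_ hU)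
    rw [tendsto_iff_dist_tendsto_zero]
    refine squeeze_zero' (Eventually.of_forall fun n => dist_nonneg) ?_
      (tendsto_one_div_add_atTop_nhds_zero_nat.comp hns.tendsto_atTop)
    filter_upwards [eventually_ge_atTop k] with n hn
    exact (hψC (ns n)).1 k (hn.trans hns.le_apply)
  have hβ : Tendsto (fun n => c + 1 / ((ns n : ℝ) + 1) - ε * ‖ψ (ns n)‖) atTop
      (𝓝 (c + 0 - ε * a)) :=
    ((tendsto_one_div_add_atTop_nhds_zero_nat.comp hns.tendsto_atTop).const_add c).sub
      (ha.const_mul ε)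
  have hmain := integral_scalarSupport_le_of_tendsto_ultrafilter hΓ hpos hint
    (ψ := fun n => ψ (ns n)) (hu.mono fun t ht => ht.comp hns.tendsto_atTop) hU hφ
    (fun n => le_sub_iff_add_le.2 (hψC (ns n)).2) hβ
  have h1 := hdet φ fun x hx => hφy x (Or.inl hx)
  have h2 := hnorm φ fun x hx => hφy x (Or.inr hx)
  have h3 := mul_le_mul_of_nonneg_left (h2.trans hφa) hε.le
  linarith

end SupportFunction

/-! ### From integrals over rational intervals to almost everywhere inequalities -/

theorem ContinuousOn.monotoneOn_of_rat {H : ℝ → ℝ} {l r : ℝ} (hH : ContinuousOn H (Icc l r))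
    (h : ∀ p q : ℚ, l ≤ p → (p : ℝ) < q → (q : ℝ) ≤ r → H p ≤ H q) : MonotoneOn H (Icc l r) := by
  intro a ha b hb hab
  by_contra! hlt
  have hab' : a < b := lt_of_le_of_ne hab fun h => by simp [h] at hlt
  obtain ⟨m, hbm, hma⟩ := exists_between hlt
  have h1 : ∀ᶠ x in 𝓝[>] a, m < H x ∧ x < (a + b) / 2 := by
    have hc : ContinuousWithinAt H (Ioc a b) a :=
      (hH a ha).mono (Ioc_subset_Icc_self.trans (Icc_subset_Icc ha.1 hb.2))
    have hc' := hc.eventually (lt_mem_nhds hma)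
    rw [nhdsWithin_Ioc_eq_nhdsGT hab'] at hc'
    exact hc'.and (nhdsWithin_le_nhds (Iio_mem_nhds (by linarith)))
  have h2 : ∀ᶠ x in 𝓝[<] b, H x < m ∧ (a + b) / 2 < x := by
    have hc : ContinuousWithinAt H (Ico a b) b :=
      (hH b hb).mono (Ico_subset_Icc_self.trans (Icc_subset_Icc ha.1 hb.2))
    have hc' := hc.eventually (gt_mem_nhds hbm)
    rw [nhdsWithin_Ico_eq_nhdsLT hab'] at hc'
    exact hc'.and (nhdsWithin_le_nhds (Ioi_mem_nhds (by linarith)))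
  obtain ⟨c, hc, hcs⟩ := (mem_nhdsGT_iff_exists_Ioo_subset' hab').1 h1
  obtain ⟨d, hd, hds⟩ := (mem_nhdsLT_iff_exists_Ioo_subset' hab').1 h2
  obtain ⟨p, hp1, hp2⟩ := exists_rat_btwn (show a < c from hc)
  obtain ⟨q, hq1, hq2⟩ := exists_rat_btwn (show d < b from hd)
  have hp := hcs ⟨hp1, hp2⟩
  have hq := hds ⟨hq1, hq2⟩
  have := h p q (ha.1.trans hp1.le) (hp.2.trans hq.2) (hq2.le.trans hb.2)
  linarith [hp.1, hq.1]

/-- The primitive of g - f is nondecreasing, and its derivative is g - f almost everywhere. Rational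
endpoints keep the number of tests countable. -/
theorem ae_le_of_forall_rat_integral_le {f g : ℝ → ℝ} (hf : IntegrableOn f (Icc 0 1) volume)
    (hg : IntegrableOn g (Icc 0 1) volume)
    (h : ∀ p q : ℚ, (0 : ℝ) ≤ p → (p : ℝ) < q → (q : ℝ) ≤ 1 →
      ∫ t in (p : ℝ)..q, f t ≤ ∫ t in (p : ℝ)..q, g t) :
    ∀ᵐ t ∂(volume.restrict (Icc (0 : ℝ) 1)), f t ≤ g t := by
  have hfi : ∀ a b : ℝ, 0 ≤ a → a ≤ b → b ≤ 1 → IntervalIntegrable f volume a b :=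
    fun a b ha hab hb => (intervalIntegrable_iff_integrableOn_Icc_of_le hab).2
      (hf.mono_set (Icc_subset_Icc ha hb))
  have hgi : ∀ a b : ℝ, 0 ≤ a → a ≤ b → b ≤ 1 → IntervalIntegrable g volume a b :=
    fun a b ha hab hb => (intervalIntegrable_iff_integrableOn_Icc_of_le hab).2
      (hg.mono_set (Icc_subset_Icc ha hb))
  have hki : ∀ a b : ℝ, 0 ≤ a → a ≤ b → b ≤ 1 →
      IntervalIntegrable (fun t => g t - f t) volume a b :=
    fun a b ha hab hb => (hgi a b ha hab hb).sub (hfi a b ha hab hb)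
  set H : ℝ → ℝ := fun x => ∫ t in (0 : ℝ)..x, (g t - f t) with hH
  have hcont : ContinuousOn H (Icc 0 1) := by
    have := intervalIntegral.continuousOn_primitive_interval' (hki 0 1 le_rfl zero_le_one le_rfl)
      (left_mem_uIcc)
    rwa [uIcc_of_le zero_le_one] at this
  have hmono : MonotoneOn H (Icc 0 1) := by
    refine hcont.monotoneOn_of_rat fun p q hp hpq hq => ?_
    rw [← sub_nonneg, hH]
    simp only
    rw [intervalIntegral.integral_interval_sub_left
      (hki 0 q le_rfl (hp.trans hpq.le) hq) (hki 0 p le_rfl hp (hpq.le.trans hq)),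
      intervalIntegral.integral_sub (hgi p q hp hpq.le hq) (hfi p q hp hpq.le hq), sub_nonneg]
    exact h p q hp hpq hq
  have hder := (hki 0 1 le_rfl zero_le_one le_rfl).ae_hasDerivAt_integral
  rw [← restrict_Ioo_eq_restrict_Icc, ae_restrict_iff' measurableSet_Ioo]
  filter_upwards [hder] with t ht hI
  have hI' : t ∈ uIcc (0 : ℝ) 1 := by
    rw [uIcc_of_le zero_le_one]
    exact Ioo_subset_Icc_self hI
  have h1 : HasDerivAt H (g t - f t) t := ht hI' 0 left_mem_uIcc
  have h2 : 0 ≤ derivWithin H (Icc 0 1) t := hmono.derivWithin_nonneg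
  rw [derivWithin_of_mem_nhds (Icc_mem_nhds hI.1 hI.2), h1.deriv] at h2
  linarith

/-! ### Pettis integrability -/

section Integrability

variable {X : Type*} [NormedAddCommGroup X] [NormedSpace ℝ X]

/-- Maximising sequences for φ₀ in the sets N([p, q]) with p, q rational are collected. Here
interval integrability supplies information that passes to every subset of [0,1]. -/
theorem exists_countable_ae_scalarSupport_le {Γ : ℝ → Set X}
    (hint : ∀ φ : X →L[ℝ] ℝ, IntegrableOn (scalarSupport Γ φ) (Icc 0 1) volume)
    (hN : ∀ a b : ℝ, 0 ≤ a → a < b → b ≤ 1 → ∃ N : Set X, ∀ φ : X →L[ℝ] ℝ,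
      supportFun φ N = ((∫ t in a..b, scalarSupport Γ φ t : ℝ) : EReal)) (φ₀ : X →L[ℝ] ℝ) :
    ∃ D : Set X, D.Countable ∧ ∀ φ : X →L[ℝ] ℝ, (∀ x ∈ D, φ x = φ₀ x) →
      ∀ᵐ t ∂(volume.restrict (Icc (0 : ℝ) 1)), scalarSupport Γ φ₀ t ≤ scalarSupport Γ φ t := by
  have hD : ∀ p q : ℚ, ∃ D : Set X, D.Countable ∧ ∀ φ : X →L[ℝ] ℝ, (∀ x ∈ D, φ x = φ₀ x) →
      (0 : ℝ) ≤ p → (p : ℝ) < q → (q : ℝ) ≤ 1 →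
      ∫ t in (p : ℝ)..q, scalarSupport Γ φ₀ t ≤ ∫ t in (p : ℝ)..q, scalarSupport Γ φ t := by
    intro p q
    by_cases h : (0 : ℝ) ≤ p ∧ (p : ℝ) < q ∧ (q : ℝ) ≤ 1
    · obtain ⟨N, hN⟩ := hN p q h.1 h.2.1 h.2.2
      obtain ⟨D, hD, hle⟩ := exists_countable_le_of_supportFun_eq (hN φ₀)
      exact ⟨D, hD, fun φ hφ _ _ _ => hle φ _ (hN φ) hφ⟩
    · exact ⟨∅, countable_empty, fun φ _ h1 h2 h3 => absurd ⟨h1, h2, h3⟩ h⟩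
  choose D hDc hD using hD
  refine ⟨⋃ p, ⋃ q, D p q, countable_iUnion fun p => countable_iUnion fun q => hDc p q,
    fun φ hφ => ?_⟩
  exact ae_le_of_forall_rat_integral_le (hint φ₀) (hint φ) fun p q h1 h2 h3 =>
    hD p q φ (fun x hx => hφ x (mem_iUnion₂.2 ⟨p, q, hx⟩)) h1 h2 h3

/-- Over a subset of `[0,1]` the integral of the support functions is a support function. -/
theorem exists_apply_le_integral_scalarSupport [CompleteSpace X] {Γ : ℝ → Set X}
    (hΓ : ∀ φ : X →L[ℝ] ℝ, ∀ᵐ t ∂(volume.restrict (Icc (0 : ℝ) 1)),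
      supportFun φ (Γ t) = (scalarSupport Γ φ t : EReal))
    (hpos : ∀ φ : X →L[ℝ] ℝ, ∀ᵐ t ∂(volume.restrict (Icc (0 : ℝ) 1)), 0 ≤ scalarSupport Γ φ t)
    (hint : ∀ φ : X →L[ℝ] ℝ, IntegrableOn (scalarSupport Γ φ) (Icc 0 1) volume)
    (hN : ∀ a b : ℝ, 0 ≤ a → a < b → b ≤ 1 → ∃ N : Set X, ∀ φ : X →L[ℝ] ℝ,
      supportFun φ N = ((∫ t in a..b, scalarSupport Γ φ t : ℝ) : EReal))
    {A : Set ℝ} (hA : A ⊆ Icc 0 1) {φ₀ : X →L[ℝ] ℝ} {c : ℝ}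
    (hc : c < ∫ t in A, scalarSupport Γ φ₀ t) :
    ∃ x : X, (∀ φ : X →L[ℝ] ℝ, φ x ≤ ∫ t in A, scalarSupport Γ φ t) ∧ c < φ₀ x := by
  have hΓA := fun φ => ae_restrict_of_ae_restrict_of_subset hA (hΓ φ)
  have hposA := fun φ => ae_restrict_of_ae_restrict_of_subset hA (hpos φ)
  have hintA : ∀ φ, Integrable (scalarSupport Γ φ) (volume.restrict A) :=
    fun φ => (hint φ).mono_set hA
  have : IsFiniteMeasure (volume.restrict A) := ⟨by
    rw [Measure.restrict_apply_univ]
    exact (measure_mono hA).trans_lt (by simp)⟩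
  refine exists_dominated_vector_of_forall_add_norm (fun φ => ∫ t in A, scalarSupport Γ φ t)
    (fun φ => integral_nonneg_of_ae (hposA φ)) (fun ε hε φ₁ d hd => ?_) hc
  refine exists_dominated_vector_of_weakStar_lsc
    (fun φ => (∫ t in A, scalarSupport Γ φ t) + ε * ‖φ‖) (fun φ ψ => ?_) (fun a φ ha => ?_)
    (fun φ d h => ?_) hd
  · have h1 := integral_scalarSupport_add_le hΓA hintA φ ψ
    have h2 := mul_le_mul_of_nonneg_left (norm_add_le φ ψ) hε.le
    linarith
  · rw [integral_scalarSupport_smul hΓA hposA hintA φ ha, norm_smul, Real.norm_of_nonneg ha]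
    ring
  · refine integral_scalarSupport_add_norm_le hΓA hposA hintA (fun ψ => ?_) hε h
    obtain ⟨D, hD, hle⟩ := exists_countable_ae_scalarSupport_le hint hN ψ
    exact ⟨D, hD, fun χ hχ => integral_mono_ae (hintA ψ) (hintA χ)
      (ae_restrict_of_ae_restrict_of_subset hA (hle χ hχ))⟩

/-- Denjoy-Pettis integrability of a positive multifunction implies its Pettis integrability, in
every family of closed convex sets that is stable under taking nonempty closed convex subsets. -/
theorem DenjoyPettisIntegrable.pettisIntegrable [CompleteSpace X] {𝒞 : Set (Set X)}
    (h𝒞 : 𝒞 ⊆ closedConvexFamily X)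
    (hsub : ∀ N ∈ 𝒞, ∀ M ∈ closedConvexFamily X, M ⊆ N → M ∈ 𝒞) {Γ : ℝ → Set X}
    (hpos : IsPositiveMultifunction Γ) (h : DenjoyPettisIntegrable 𝒞 Γ) :
    PettisIntegrable 𝒞 Γ := by
  have hΓ : ∀ φ : X →L[ℝ] ℝ, ∀ᵐ t ∂(volume.restrict (Icc (0 : ℝ) 1)),
      supportFun φ (Γ t) = (scalarSupport Γ φ t : EReal) := by
    intro φ
    obtain ⟨F, hF⟩ := h.1 φ
    filter_upwards [hF.2] with t ⟨D, _, hD⟩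
    rw [scalarSupport, hD, EReal.toReal_coe]
  have hpos' : ∀ φ : X →L[ℝ] ℝ, ∀ᵐ t ∂(volume.restrict (Icc (0 : ℝ) 1)),
      0 ≤ scalarSupport Γ φ t := fun φ => by
    filter_upwards [hpos φ] with t ht
    exact EReal.toReal_nonneg ht
  have hint : ∀ φ : X →L[ℝ] ℝ, IntegrableOn (scalarSupport Γ φ) (Icc 0 1) volume := fun φ => by
    obtain ⟨F, hF⟩ := h.1 φ
    exact (hF.integral_of_nonneg (hpos φ)).1
  have hN : ∀ a b : ℝ, 0 ≤ a → a < b → b ≤ 1 → ∃ N ∈ 𝒞, ∀ φ : X →L[ℝ] ℝ,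
      supportFun φ N = ((∫ t in a..b, scalarSupport Γ φ t : ℝ) : EReal) := by
    intro a b ha hab hb
    obtain ⟨N, hN𝒞, hN⟩ := h.2 a b ha hab hb
    refine ⟨N, hN𝒞, fun φ => ?_⟩
    obtain ⟨v, ⟨F, hF, hv⟩, hNv⟩ := hN φ
    rw [hNv, ← hv, (hF.integral_of_nonneg (hpos φ)).2 a b ha hab.le hb]
    rfl
  refine ⟨fun φ => ⟨?_, hint φ⟩, fun A hA _ => ?_⟩
  · filter_upwards [hΓ φ] with t ht
    rw [ht]
    exact ⟨EReal.coe_ne_top _, EReal.coe_ne_bot _⟩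
  set M : Set X := {x | ∀ φ : X →L[ℝ] ℝ, φ x ≤ ∫ t in A, scalarSupport Γ φ t} with hM
  have hnn : ∀ φ : X →L[ℝ] ℝ, 0 ≤ ∫ t in A, scalarSupport Γ φ t := fun φ =>
    integral_nonneg_of_ae (ae_restrict_of_ae_restrict_of_subset hA (hpos' φ))
  have hMc : M ∈ closedConvexFamily X := by
    refine ⟨⟨0, fun φ => by simpa using hnn φ⟩, ?_, ?_⟩
    · rw [hM, ofPred_forall]
      exact isClosed_iInter fun φ => isClosed_le φ.continuous continuous_const
    · rw [hM, ofPred_forall]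
      exact convex_iInter fun φ => convex_halfSpace_le φ.toLinearMap.isLinear _
  obtain ⟨N, hN𝒞, hN01⟩ := hN 0 1 le_rfl one_pos le_rfl
  -- A point of `M` outside the closed convex set `N` is separated by some `f`, against ∫_A s(f, Γ)
  -- ≤ ∫_[0,1] s(f, Γ).
  have hMN : M ⊆ N := by
    intro x hx
    by_contra hxN
    obtain ⟨f, u, hfu, hux⟩ :=
      geometric_hahn_banach_closed_point (h𝒞 hN𝒞).2.2 (h𝒞 hN𝒞).2.1 hxN
    have h1 := le_of_supportFun_eq (hN01 f) fun y hy => (hfu y hy).le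
    have h2 : ∫ t in A, scalarSupport Γ f t ≤ ∫ t in (0 : ℝ)..1, scalarSupport Γ f t := by
      rw [intervalIntegral.integral_of_le zero_le_one, ← integral_Icc_eq_integral_Ioc]
      exact setIntegral_mono_set (hint f) (hpos' f) (LE.le.eventuallyLE hA)
    linarith [hx f]
  refine ⟨M, hsub N hN𝒞 M hMc hMN, fun φ => supportFun_eq_coe (fun x hx => hx φ) fun c hc => ?_⟩
  exact exists_apply_le_integral_scalarSupport hΓ hpos' hint
    (fun a b ha hab hb => (hN a b ha hab hb).imp fun _ h => h.2) hA hc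

end Integrability

theorem theorem3p3 {X : Type*} [NormedAddCommGroup X] [NormedSpace ℝ X] [CompleteSpace X]
    (Γ : ℝ → Set X) (hΓ : IsMultifunction Γ) (hpos : IsPositiveMultifunction Γ) :
    (DenjoyPettisIntegrable (cbFamily X) Γ → PettisIntegrable (cbFamily X) Γ) ∧
    (DenjoyPettisIntegrable (cwkFamily X) Γ → PettisIntegrable (cwkFamily X) Γ) ∧
    (DenjoyPettisIntegrable (ckFamily X) Γ → PettisIntegrable (ckFamily X) Γ) := by
  refine ⟨fun h => h.pettisIntegrable (fun C hC => hC.1) ?_ hpos,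
    fun h => h.pettisIntegrable (fun C hC => hC.1) ?_ hpos,
    fun h => h.pettisIntegrable (fun C hC => hC.1) ?_ hpos⟩
  · exact fun N hN M hM hMN => ⟨hM, hN.2.subset hMN⟩
  · intro N hN M hM hMN
    refine ⟨hM, hN.2.of_isClosed_subset ?_ (image_mono hMN)⟩
    -- By Mazur's theorem a norm closed convex set is weakly closed.
    rw [← hM.2.1.closure_eq, hM.2.2.toWeakSpace_closure ℝ]
    exact isClosed_closure
  · exact fun N hN M hM hMN => ⟨hM, hN.2.of_isClosed_subset hM.2.1 hMN⟩
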